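/- Let $\mathbb{K}$ be a field of characteristic $0$ and let $q\in\mathbb{K}^*$ be not a root of unity; put $\hat q=q-q^{-1}$. Let $U=U_q(\mathfrak{sl}_4^+)$ be the unital associative $\mathbb{K}$-algebra with generators $e_1,e_2,e_3$ and relations $e_1e_3=e_3e_1$ and $e_i^2e_j-(q+q^{-1})e_ie_je_i+e_je_i^2=0$ for $|i-j|=1$. Set $$X_1=e_1,\quad X_2=e_1e_2-q^{-1}e_2e_1,\quad X_4=e_2,\quad X_5=e_2e_3-q^{-1}e_3e_2,\quad X_6=e_3,\quad X_3=e_1X_5-q^{-1}X_5e_1,$$ $$\Delta_1=X_3,\qquad \Delta_2=X_2X_5-qX_3X_4,\qquad \Delta_3=\hat q^{\,2}X_1X_4X_6-q\hat q\,X_2X_6-q\hat q\,X_1X_5+q^2X_3,$$ and $z_1=\Delta_1\Delta_3$, $z_2=\Delta_2$. Let $Z(U)$ be the center of $U$, let $\mathrm{Der}(U)$ be the $Z(U)$-module of $\mathbb{K}$-linear derivations of $U$, let $\mathrm{ad}_x(a)=xa-ax$, let $\mathrm{InnDer}(U)=\{\mathrm{ad}_x\mid x\in U\}$, and let $\mathrm{HH}^1(U)=\mathrm{Der}(U)/\mathrm{InnDer}(U)$.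 There are derivations $D_1,D_4,D_6$ of $U$ (unique, since the $X_i$ generate $U$) such that $D_1(X_j)=X_j$ for $j\in\{1,2,3\}$, $D_4(X_j)=X_j$ for $j\in\{2,3,4,5\}$, $D_6(X_j)=X_j$ for $j\in\{3,5,6\}$, and $D_i(X_j)=0$ for all other $j\in\{1,\dots,6\}$. The center $Z(U)$ is the polynomial algebra $\mathbb{K}[z_1,z_2]$ in the two variables $z_1,z_2$. Moreover: 1. Every derivation $D$ of $U$ can be uniquely written as $$D=\mathrm{ad}_x+\mu_1D_1+\mu_4D_4+\mu_6D_6$$ with $\mathrm{ad}_x\in\mathrm{InnDer}(U)$ and $\mu_1,\mu_4,\mu_6\in Z(U)$ (that is, the inner derivation $\mathrm{ad}_x$ and the coefficients $\mu_i$ are unique; $x$ itself is unique only up to adding a central element). 2. $\mathrm{HH}^1(U)$ is a free $Z(U)$-module of rank $3$, with basis the classes $(\overline{D_1},\overline{D_4},\overline{D_6})$. -/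

import Mathlib

/-!
# The algebra `U_q(sl_4^+)`, its derivations and its first Hochschild cohomology
-/

namespace UqSl4

/-- The quantum Serre relations of type `A_3` on the generators `e_1, e_2, e_3`
(indexed here by `0, 1, 2 : Fin 3`). -/
inductive SerreRel (K : Type*) [Field K] (q : K) :
    FreeAlgebra K (Fin 3) → FreeAlgebra K (Fin 3) → Prop
  | comm : SerreRel K q
      (FreeAlgebra.ι K 0 * FreeAlgebra.ι K 2 - FreeAlgebra.ι K 2 * FreeAlgebra.ι K 0) 0
  | serre (i j : Fin 3) (hij : |((i : ℕ) : ℤ) - ((j : ℕ) : ℤ)| = 1) : SerreRel K q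
      (FreeAlgebra.ι K i ^ 2 * FreeAlgebra.ι K j
        - (q + q⁻¹) • (FreeAlgebra.ι K i * FreeAlgebra.ι K j * FreeAlgebra.ι K i)
        + FreeAlgebra.ι K j * FreeAlgebra.ι K i ^ 2) 0

/-- `U_q(sl_4^+)`: the unital associative `K`-algebra generated by `e_1, e_2, e_3` subject to the
quantum Serre relations. -/
def Uq (K : Type*) [Field K] (q : K) : Type _ := RingQuot (SerreRel K q)

instance (K : Type*) [Field K] (q : K) : Ring (Uq K q) :=
  inferInstanceAs (Ring (RingQuot (SerreRel K q)))

instance (K : Type*) [Field K] (q : K) : Algebra K (Uq K q) :=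
  inferInstanceAs (Algebra K (RingQuot (SerreRel K q)))

section Elements

variable (K : Type*) [Field K] (q : K)

/-- The quotient map from the free algebra. -/
def mk : FreeAlgebra K (Fin 3) →ₐ[K] Uq K q := RingQuot.mkAlgHom K (SerreRel K q)

/-- The Chevalley generators; `e K q 0`, `e K q 1`, `e K q 2` are `e_1`, `e_2`, `e_3`. -/
def e (i : Fin 3) : Uq K q := mk K q (FreeAlgebra.ι K i)

/-! The six generators of the PBW basis. -/

def X1 : Uq K q := e K q 0
def X2 : Uq K q := e K q 0 * e K q 1 - q⁻¹ • (e K q 1 * e K q 0)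
def X4 : Uq K q := e K q 1
def X5 : Uq K q := e K q 1 * e K q 2 - q⁻¹ • (e K q 2 * e K q 1)
def X6 : Uq K q := e K q 2
def X3 : Uq K q := e K q 0 * X5 K q - q⁻¹ • (X5 K q * e K q 0)

/-! The three normal elements `Δ_1, Δ_2, Δ_3`, and `z_1 = Δ_1 Δ_3`, `z_2 = Δ_2`. -/

def Δ1 : Uq K q := X3 K q
def Δ2 : Uq K q := X2 K q * X5 K q - q • (X3 K q * X4 K q)
def Δ3 : Uq K q :=
  (q - q⁻¹) ^ 2 • (X1 K q * X4 K q * X6 K q) - (q * (q - q⁻¹)) • (X2 K q * X6 K q)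
    - (q * (q - q⁻¹)) • (X1 K q * X5 K q) + q ^ 2 • X3 K q
def z1 : Uq K q := Δ1 K q * Δ3 K q
def z2 : Uq K q := Δ2 K q

end Elements

section Derivations

variable (K : Type*) [Field K] (A : Type*) [Ring A] [Algebra K A]

/-- The module, over the center of the (not necessarily commutative) `K`-algebra `A`, of the
`K`-linear derivations of `A`; a central `z` acts by `(z • D) a = z * D a`. -/
def Der : Submodule (Subalgebra.center K A) (A →ₗ[K] A) where
  carrier := {D | ∀ a b : A, D (a * b) = D a * b + a * D b}
  zero_mem' := by intro a b; simp
  add_mem' := by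
    intro D E hD hE a b
    simp only [LinearMap.add_apply, hD a b, hE a b]
    noncomm_ring
  smul_mem' := by
    intro z D hD a b
    have hz : ∀ x : A, (z : A) * x = x * (z : A) := fun x =>
      ((Subalgebra.mem_center_iff.mp z.2) x).symm
    simp only [LinearMap.smul_apply, hD a b, Subalgebra.smul_def, smul_eq_mul, mul_add,
      ← mul_assoc, hz a]

/-- The inner derivation `ad_x : a ↦ x a - a x`. -/
def ad (x : A) : Der K A :=
  ⟨LinearMap.mulLeft K x - LinearMap.mulRight K x, by
    intro a b
    simp only [LinearMap.sub_apply, LinearMap.mulLeft_apply, LinearMap.mulRight_apply]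
    noncomm_ring⟩

theorem ad_apply (x a : A) : (ad K A x : A →ₗ[K] A) a = x * a - a * x := rfl

/-- The inner derivations, as a submodule of all derivations. -/
def InnDer : Submodule (Subalgebra.center K A) (Der K A) where
  carrier := {D | ∃ x : A, D = ad K A x}
  zero_mem' := ⟨0, by ext a; simp [ad_apply]⟩
  add_mem' := by
    rintro _ _ ⟨x, rfl⟩ ⟨y, rfl⟩
    refine ⟨x + y, ?_⟩
    ext a
    simp only [Submodule.coe_add, LinearMap.add_apply, ad_apply]
    noncomm_ring
  smul_mem' := by
    rintro z _ ⟨x, rfl⟩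
    refine ⟨(z : A) * x, ?_⟩
    ext a
    have hz : a * (z : A) = (z : A) * a := (Subalgebra.mem_center_iff.mp z.2) a
    simp only [Submodule.coe_smul, LinearMap.smul_apply, ad_apply, Subalgebra.smul_def,
      smul_eq_mul, mul_sub, ← mul_assoc, hz]

/-! Shortcut instances, for the quotient below to elaborate. -/

instance : Ring (Subalgebra.center K A) := inferInstance
instance : AddCommGroup (Der K A) := inferInstance
instance : Module (Subalgebra.center K A) (Der K A) := inferInstance

/-- The first Hochschild cohomology `HH¹(A) = Der(A) / InnDer(A)`, a module over the center. -/
abbrev HH1 : Type _ := Der K A ⧸ InnDer K A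

end Derivations

section Diagonal

variable (K : Type*) [Field K] (q : K)

theorem mk_rel {x y : FreeAlgebra K (Fin 3)} (h : SerreRel K q x y) : mk K q x = mk K q y :=
  RingQuot.mkAlgHom_rel K h

theorem e_comm : e K q 0 * e K q 2 - e K q 2 * e K q 0 = 0 := by
  simpa only [e, map_sub, map_mul, map_zero] using mk_rel K q SerreRel.comm

theorem e_serre (i j : Fin 3) (hij : |((i : ℕ) : ℤ) - ((j : ℕ) : ℤ)| = 1) :
    e K q i ^ 2 * e K q j - (q + q⁻¹) • (e K q i * e K q j * e K q i)
      + e K q j * e K q i ^ 2 = 0 := by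
  simpa only [e, map_add, map_sub, map_mul, map_zero, map_smul, map_pow] using
    mk_rel K q (SerreRel.serre i j hij)

theorem algHom_ext {B : Type*} [Semiring B] [Algebra K B] {f g : Uq K q →ₐ[K] B}
    (h : ∀ i, f (e K q i) = g (e K q i)) : f = g :=
  RingQuot.ringQuot_ext' (S := K) (s := SerreRel K q) f g (FreeAlgebra.hom_ext (funext h))

/-- The homomorphism `e_i ↦ e_i + ε w_i e_i` from the free algebra to the dual numbers over
`U_q(sl_4^+)`. -/
def freeToDual (w : Fin 3 → K) : FreeAlgebra K (Fin 3) →ₐ[K] DualNumber (Uq K q) :=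
  FreeAlgebra.lift K fun i =>
    (TrivSqZeroExt.inl (e K q i) + TrivSqZeroExt.inr (w i • e K q i) : DualNumber (Uq K q))

theorem freeToDual_rel (w : Fin 3 → K) {x y : FreeAlgebra K (Fin 3)} (h : SerreRel K q x y) :
    freeToDual K q w x = freeToDual K q w y := by
  unfold freeToDual
  induction h with
  | comm =>
    simp only [map_sub, map_mul, map_zero, FreeAlgebra.lift_ι_apply]
    ext
    · simpa using e_comm K q
    · simp
      have h2 : e K q 0 * e K q 2 = e K q 2 * e K q 0 := sub_eq_zero.mp (e_comm K q)
      rw [h2]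
      abel
  | serre i j hij =>
    have h := e_serre K q i j hij
    simp only [map_add, map_sub, map_mul, map_zero, map_smul, map_pow,
      FreeAlgebra.lift_ι_apply]
    ext
    · simpa using h
    · have h' := congrArg (fun t => (2 * w i + w j) • t) h
      simp only [smul_zero] at h'
      simp [pow_two]
      rw [← h']
      simp only [pow_two, smul_add, smul_sub, mul_add, mul_smul_comm, ← mul_assoc]
      module

/-- The induced homomorphism on `U_q(sl_4^+)`. -/
def toDual (w : Fin 3 → K) : Uq K q →ₐ[K] DualNumber (Uq K q) :=
  RingQuot.liftAlgHom K ⟨freeToDual K q w, fun _ _ h => freeToDual_rel K q w h⟩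

theorem toDual_e (w : Fin 3 → K) (i : Fin 3) :
    toDual K q w (e K q i) =
      TrivSqZeroExt.inl (e K q i) + TrivSqZeroExt.inr (w i • e K q i) := by
  have h : toDual K q w (e K q i) = freeToDual K q w (FreeAlgebra.ι K i) :=
    RingQuot.liftAlgHom_mkAlgHom_apply K _ _ _
  rw [h, freeToDual, FreeAlgebra.lift_ι_apply]

theorem toDual_fst (w : Fin 3 → K) (a : Uq K q) : (toDual K q w a).fst = a := by
  have h : (TrivSqZeroExt.fstHom K (Uq K q) (Uq K q)).comp (toDual K q w) = AlgHom.id K _ := by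
    apply algHom_ext
    intro i
    simp [toDual_e]
  exact DFunLike.congr_fun h a

/-- The derivation of `U_q(sl_4^+)` determined by `e_i ↦ w_i e_i`. -/
def diagDer (w : Fin 3 → K) : Der K (Uq K q) :=
  ⟨{ toFun := fun a => (toDual K q w a).snd
     map_add' := by intro a b; simp
     map_smul' := by intro c a; simp }, by
    intro a b
    simp [toDual_fst, add_comm]⟩

theorem diagDer_e (w : Fin 3 → K) (i : Fin 3) :
    (diagDer K q w : Uq K q →ₗ[K] Uq K q) (e K q i) = w i • e K q i := by
  simp [diagDer, toDual_e]

/-- `D_1` : `X_1, X_2, X_3` are fixed, `X_4, X_5, X_6` are sent to `0`. -/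
def D1 : Der K (Uq K q) := diagDer K q ![1, 0, 0]

/-- `D_4` : `X_2, X_3, X_4, X_5` are fixed, `X_1, X_6` are sent to `0`. -/
def D4 : Der K (Uq K q) := diagDer K q ![0, 1, 0]

/-- `D_6` : `X_3, X_5, X_6` are fixed, `X_1, X_2, X_4` are sent to `0`. -/
def D6 : Der K (Uq K q) := diagDer K q ![0, 0, 1]

/-- `D` acts on the PBW generators by `X_i ↦ c_i X_i`, where `c = ![c_1, …, c_6]`. -/
def IsDiagonalOnPBW (D : Der K (Uq K q)) (c : Fin 6 → K) : Prop :=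
  ∀ i : Fin 6, (D : Uq K q →ₗ[K] Uq K q)
      (![X1 K q, X2 K q, X3 K q, X4 K q, X5 K q, X6 K q] i) =
    c i • (![X1 K q, X2 K q, X3 K q, X4 K q, X5 K q, X6 K q] i)

theorem diagDer_PBW (w : Fin 3 → K) : IsDiagonalOnPBW K q (diagDer K q w)
    ![w 0, w 0 + w 1, w 0 + w 1 + w 2, w 1, w 1 + w 2, w 2] := by
  have hL := (diagDer K q w).2
  intro i
  fin_cases i <;>
  · simp [X1, X2, X3, X4, X5, X6, hL _ _, diagDer_e]
    try simp only [mul_sub, sub_mul, mul_add, add_mul, smul_sub, smul_add, mul_smul_comm, smul_mul_assoc]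
    try module

end Diagonal

end UqSl4

/-!
The algebra `U = U_q(sl_4^+)` is embedded by `toTorus` into a quantum torus of rank six, in which
the PBW generators have as leading monomials the six generators `t_1, …, t_6` of the torus. Since
the PBW monomials span `U` (`span_pbw`), every nonzero element of `U` has a leading exponent without
negative coordinates (`exists_isLead`), which gives injectivity (`toTorus_injective`) and a
splitting of the torus into `U` and the monomials whose exponent has a negative coordinate
(`exists_sub_hasNeg`).

*Center.* Six elements of `U` (the `cluster`) become monomials in the torus which generate it up to
inverses, so an element of `U` is central exactly if all of its exponents lie in the radical of the
commutation form. These exponents are the integral combinations of those of `z_1` and `z_2`, and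
the splitting leaves only polynomials in `z_1, z_2` (`center_eq_adjoin`).

*Derivations.* As `q` is not a root of unity, comparing coefficients in the relations between the
members of the cluster shows that every derivation of `U` is the restriction of
`[x, -] + diag ζ` for some `x` in the torus and an additive map `ζ` from exponents to the center of
the torus (`exists_eq_torusDer`). The derivation preserves `U`, and `U` is contained not only in the
given torus but also in the tori obtained by mutating one cluster variable. The mutated variable is
a sum of two monomials, and `ζ` must take the same value on both of them
(`eq_of_torusDer_mem_mutSpan`). Applied to three mutations (`exchange_X1`, `exchange_X2`,
`exchange_X2op`), this cuts the rank of `ζ` from six to three: `diag ζ` is a combination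
of `D_1, D_4, D_6` with coefficients in the center of the torus (`diag_toTorus`). By the splitting,
`x` and the coefficients may be changed by elements of `U` and `Z(U)` so that only exponents with a
negative coordinate remain; looking at the leading terms of the values on the `X_i`, nothing is
left (`eq_zero_of_hasNeg_of_mem_range`). This is `exists_decomposition`.

*Uniqueness.* The elements `X_1, X_2, X_3` become monomials up to scalars, and an inner derivation
cannot multiply a monomial by a nonzero central element (`eq_zero_of_ad_add`). The weights of
`D_1, D_4, D_6` on these three elements form a unitriangular matrix.
-/

namespace UqSl4

/-! ### Quantum tori -/

section QuantumTorus

/-- The quantum torus on the lattice `G`: the vector space with basis the monomials `M v`, `v ∈ G`,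
multiplied by `M v * M w = q ^ Ω(v, w) • M (v + w)`, where `Ω` is any (not necessarily
skew-symmetric) bilinear form. -/
def QTorus {K : Type*} [Field K] {G : Type*} [AddCommGroup G] (_q : Kˣ) (_Ω : G →+ G →+ ℤ) :
    Type _ := G →₀ K

namespace QTorus

variable {K : Type*} [Field K] {G : Type*} [AddCommGroup G] {q : Kˣ} {Ω : G →+ G →+ ℤ}

noncomputable instance : AddCommGroup (QTorus q Ω) := inferInstanceAs (AddCommGroup (G →₀ K))
noncomputable instance : Module K (QTorus q Ω) := inferInstanceAs (Module K (G →₀ K))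

variable (q Ω) in
/-- The monomial with exponent `v`. -/
noncomputable def M (v : G) : QTorus q Ω := Finsupp.single v (1 : K)

/-- The coefficient of the monomial `M v`. -/
noncomputable def coeff (v : G) : QTorus q Ω →ₗ[K] K := Finsupp.lapply v

/-- The finite set of exponents which occur in an element. -/
noncomputable def supp (f : QTorus q Ω) : Finset G := Finsupp.support f

theorem mem_supp {f : QTorus q Ω} {v : G} : v ∈ supp f ↔ coeff v f ≠ 0 := Finsupp.mem_support_iff

theorem ext {f g : QTorus q Ω} (h : ∀ v, coeff v f = coeff v g) : f = g := Finsupp.ext h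

theorem coeff_M [DecidableEq G] (v w : G) : coeff w (M q Ω v) = if v = w then 1 else 0 :=
  Finsupp.single_apply

/-- The linear map given by prescribed values on the monomials. -/
noncomputable def lift {V : Type*} [AddCommGroup V] [Module K V] (f : G → V) :
    QTorus q Ω →ₗ[K] V := Finsupp.linearCombination K f

@[simp] theorem lift_M {V : Type*} [AddCommGroup V] [Module K V] (f : G → V) (v : G) :
    lift f (M q Ω v) = f v := by
  exact (Finsupp.linearCombination_single K (1 : K) v).trans (one_smul K _)

theorem lhom_ext {V : Type*} [AddCommGroup V] [Module K V] {f g : QTorus q Ω →ₗ[K] V}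
    (h : ∀ v, f (M q Ω v) = g (M q Ω v)) : f = g := by
  refine Finsupp.lhom_ext (M := K) (fun v c => ?_)
  have hv : (Finsupp.single v c : G →₀ K) = c • Finsupp.single v (1 : K) := by simp
  rw [hv]
  exact (map_smul f c (M q Ω v)).trans ((congrArg (c • ·) (h v)).trans (map_smul g c (M q Ω v)).symm)

theorem eq_sum (f : QTorus q Ω) : f = ∑ v ∈ supp f, coeff v f • M q Ω v := by
  refine (Finsupp.sum_single (f : G →₀ K)).symm.trans (Finset.sum_congr rfl fun v _ => ?_)
  exact ((Finsupp.smul_single _ v (1 : K)).trans (by rw [smul_eq_mul, mul_one]; rfl)).symm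

theorem induction {p : QTorus q Ω → Prop} (h0 : p 0) (hadd : ∀ f g, p f → p g → p (f + g))
    (hM : ∀ (c : K) v, p (c • M q Ω v)) (f : QTorus q Ω) : p f := by
  rw [eq_sum f]
  exact Finset.sum_induction _ p hadd h0 fun v _ => hM _ v

/-- The multiplication as a bilinear map. -/
noncomputable def mulHom : QTorus q Ω →ₗ[K] QTorus q Ω →ₗ[K] QTorus q Ω :=
  lift fun v => lift fun w => ((q ^ Ω v w : Kˣ) : K) • M q Ω (v + w)

noncomputable instance : Mul (QTorus q Ω) := ⟨fun f g => mulHom f g⟩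
noncomputable instance : One (QTorus q Ω) := ⟨M q Ω 0⟩

theorem mul_def (f g : QTorus q Ω) : f * g = mulHom f g := rfl

theorem one_def : (1 : QTorus q Ω) = M q Ω 0 := rfl

theorem M_mul_M (v w : G) : M q Ω v * M q Ω w = ((q ^ Ω v w : Kˣ) : K) • M q Ω (v + w) := by
  simp [mul_def, mulHom]

theorem smul_mul_aux (c : K) (f g : QTorus q Ω) : (c • f) * g = c • (f * g) := by
  simp [mul_def]

theorem mul_smul_aux (c : K) (f g : QTorus q Ω) : f * (c • g) = c • (f * g) := by
  simp [mul_def]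

noncomputable instance : Ring (QTorus q Ω) where
  __ := (inferInstance : AddCommGroup (QTorus q Ω))
  mul := (· * ·)
  one := 1
  left_distrib f g h := by simp [mul_def]
  right_distrib f g h := by simp [mul_def]
  zero_mul f := by simp [mul_def]
  mul_zero f := by simp [mul_def]
  one_mul f := by
    have : (mulHom (1 : QTorus q Ω)) = LinearMap.id := lhom_ext fun v => by
      rw [← mul_def, one_def, M_mul_M]; simp
    exact DFunLike.congr_fun this f
  mul_one f := by
    have : (mulHom (q := q) (Ω := Ω)).flip 1 = LinearMap.id := lhom_ext fun v => by
      rw [LinearMap.flip_apply, ← mul_def, one_def, M_mul_M]; simp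
    exact DFunLike.congr_fun this f
  mul_assoc f g h := by
    have hadd : ∀ f₁ f₂ g : QTorus q Ω, (f₁ + f₂) * g = f₁ * g + f₂ * g := by simp [mul_def]
    have hadd' : ∀ f g₁ g₂ : QTorus q Ω, f * (g₁ + g₂) = f * g₁ + f * g₂ := by simp [mul_def]
    have h0 : ∀ f : QTorus q Ω, 0 * f = 0 := by simp [mul_def]
    have h0' : ∀ f : QTorus q Ω, f * 0 = 0 := by simp [mul_def]
    induction f using induction with
    | h0 => simp only [h0]
    | hadd f₁ f₂ h₁ h₂ => rw [hadd, hadd, hadd, h₁, h₂]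
    | hM a u =>
      induction g using induction with
      | h0 => simp only [h0, h0']
      | hadd f₁ f₂ h₁ h₂ => rw [hadd, hadd', hadd, hadd', h₁, h₂]
      | hM b v =>
        induction h using induction with
        | h0 => simp only [h0']
        | hadd f₁ f₂ h₁ h₂ => rw [hadd', hadd', hadd', h₁, h₂]
        | hM c w =>
          simp only [smul_mul_aux, mul_smul_aux, M_mul_M, smul_smul, map_add,
            AddMonoidHom.add_apply, add_assoc, zpow_add, Units.val_mul]
          congr 1
          ring

noncomputable instance : Algebra K (QTorus q Ω) :=
  Algebra.ofModule smul_mul_aux mul_smul_aux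

theorem coeff_mul_M (f : QTorus q Ω) (v w : G) :
    coeff v (f * M q Ω w) = coeff (v - w) f * ((q ^ Ω (v - w) w : Kˣ) : K) := by
  classical
  induction f using induction with
  | h0 => simp
  | hadd f g hf hg => rw [add_mul, map_add, map_add, hf, hg, add_mul]
  | hM c u =>
    rw [smul_mul_assoc, M_mul_M]
    simp only [map_smul, coeff_M, smul_eq_mul]
    by_cases h : u = v - w
    · subst h; simp
    · rw [if_neg h, if_neg (fun h' => h (by rw [← h']; abel))]; simp

theorem coeff_M_mul (f : QTorus q Ω) (v w : G) :
    coeff v (M q Ω w * f) = coeff (v - w) f * ((q ^ Ω w (v - w) : Kˣ) : K) := by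
  classical
  induction f using induction with
  | h0 => simp
  | hadd f g hf hg => rw [mul_add, map_add, map_add, hf, hg, add_mul]
  | hM c u =>
    rw [mul_smul_comm, M_mul_M]
    simp only [map_smul, coeff_M, smul_eq_mul]
    by_cases h : u = v - w
    · subst h; simp
    · rw [if_neg h, if_neg (fun h' => h (by rw [← h']; abel))]; simp

variable (Ω) in
/-- The skew-symmetric commutation form: `M v * M w = q ^ β(v, w) • (M w * M v)`. -/
def β (v w : G) : ℤ := Ω v w - Ω w v

theorem M_comm (v w : G) : M q Ω v * M q Ω w = ((q ^ β Ω v w : Kˣ) : K) • (M q Ω w * M q Ω v) := by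
  rw [M_mul_M, M_mul_M, smul_smul, ← Units.val_mul, ← zpow_add, add_comm w v]
  simp [β]

theorem β_add_right (u v w : G) : β Ω u (v + w) = β Ω u v + β Ω u w := by
  simp [β]; ring

theorem β_sub_left (u v w : G) : β Ω (u - v) w = β Ω u w - β Ω v w := by
  simp [β]; ring

theorem β_zsmul_right (u v : G) (n : ℤ) : β Ω u (n • v) = n * β Ω u v := by
  simp [β]; ring

theorem β_swap (u v : G) : β Ω u v = - β Ω v u := by
  simp [β]

theorem isUnit_M (v : G) : IsUnit (M q Ω v) := by
  rw [isUnit_iff_exists]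
  refine ⟨((q ^ Ω v v : Kˣ) : K) • M q Ω (-v), ?_, ?_⟩
  · rw [mul_smul_comm, M_mul_M, smul_smul, ← Units.val_mul, ← zpow_add]; simp [one_def]
  · rw [smul_mul_assoc, M_mul_M, smul_smul, ← Units.val_mul, ← zpow_add]; simp [one_def]

/-! ### Leading terms -/

section Lead

variable {Γ : Type*} [AddCommGroup Γ] [LinearOrder Γ] (κ : G →+ Γ)

/-- All exponents of `f` are at most `v`, for the order pulled back along `κ`. -/
def SuppLE (f : QTorus q Ω) (v : G) : Prop := ∀ w, coeff w f ≠ 0 → κ w ≤ κ v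

/-- The monomial `M v` is the leading term of `f`, for the order pulled back along `κ`. -/
def IsLead (f : QTorus q Ω) (v : G) : Prop := SuppLE κ f v ∧ coeff v f ≠ 0

variable {κ}

theorem SuppLE.add {f g : QTorus q Ω} {v : G} (hf : SuppLE κ f v) (hg : SuppLE κ g v) : SuppLE κ (f + g) v := by
  intro w hw
  by_contra h
  apply hw
  rw [map_add, not_not.mp (mt (hf w) h), not_not.mp (mt (hg w) h), add_zero]

theorem SuppLE.sum {ι : Type*} {s : Finset ι} {f : ι → QTorus q Ω} {v : G}
    (hf : ∀ i ∈ s, SuppLE κ (f i) v) : SuppLE κ (∑ i ∈ s, f i) v := by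
  refine Finset.sum_induction f (fun f => SuppLE κ f v) (fun _ _ => SuppLE.add) ?_ hf
  intro w hw
  simp at hw

theorem SuppLE.smul {f : QTorus q Ω} {v : G} (hf : SuppLE κ f v) (c : K) : SuppLE κ (c • f) v := by
  intro w hw
  refine hf w fun h => hw ?_
  simp [h]

theorem SuppLE.mono {f : QTorus q Ω} {v w : G} (hf : SuppLE κ f v) (h : κ v ≤ κ w) : SuppLE κ f w :=
  fun u hu => (hf u hu).trans h

theorem suppLE_M (v : G) : SuppLE κ (M q Ω v) v := by
  classical
  intro w hw
  rw [coeff_M] at hw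
  have : v = w := by by_contra h; simp [h] at hw
  rw [this]

theorem IsLead.unique (hκ : Function.Injective κ) {f : QTorus q Ω} {v w : G}
    (hv : IsLead κ f v) (hw : IsLead κ f w) : v = w :=
  hκ (le_antisymm (hw.1 v hv.2) (hv.1 w hw.2))

theorem isLead_M (v : G) : IsLead κ (M q Ω v) v := by
  classical
  exact ⟨suppLE_M v, by rw [coeff_M]; simp⟩

theorem IsLead.smul {f : QTorus q Ω} {v : G} (hf : IsLead κ f v) {c : K} (hc : c ≠ 0) :
    IsLead κ (c • f) v :=
  ⟨hf.1.smul c, by rw [map_smul]; exact mul_ne_zero hc hf.2⟩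

theorem IsLead.add {f g : QTorus q Ω} {v w : G} (hf : IsLead κ f v) (hg : SuppLE κ g w)
    (h : κ w < κ v) : IsLead κ (f + g) v := by
  refine ⟨hf.1.add (hg.mono h.le), ?_⟩
  rw [map_add, not_not.mp (mt (hg v) (not_le.mpr h)), add_zero]
  exact hf.2

theorem IsLead.one : IsLead κ (1 : QTorus q Ω) 0 := isLead_M 0

/-- A nontrivial linear combination of elements with distinct leading terms has one of these
as its leading term. -/
theorem exists_isLead_sum (hκ : Function.Injective κ) {ι : Type*} {s : Finset ι} (c : ι → K)
    {f : ι → QTorus q Ω} {v : ι → G} (hv : Function.Injective v) (hf : ∀ i, IsLead κ (f i) (v i))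
    (hs : ∃ i ∈ s, c i ≠ 0) : ∃ i ∈ s, c i ≠ 0 ∧ IsLead κ (∑ i ∈ s, c i • f i) (v i) := by
  classical
  obtain ⟨j, hj, hjmax⟩ := Finset.exists_max_image (s.filter fun i => c i ≠ 0)
    (fun i => κ (v i)) (by obtain ⟨i, hi, hc⟩ := hs; exact ⟨i, by simp [hi, hc]⟩)
  rw [Finset.mem_filter] at hj
  refine ⟨j, hj.1, hj.2, SuppLE.sum fun i hi => ?_, ?_⟩
  · by_cases hc : c i = 0
    · intro w hw; simp [hc] at hw
    · exact ((hf i).1.smul _).mono (hjmax i (by simp [hi, hc]))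
  · rw [map_sum, Finset.sum_eq_single j]
    · simpa using ⟨hj.2, (hf j).2⟩
    · intro i hi hij
      by_cases hc : c i = 0
      · simp [hc]
      · have h1 := hjmax i (by simp [hi, hc])
        have : coeff (v j) (f i) = 0 := by
          by_contra h
          exact hij (hv (hκ (le_antisymm h1 ((hf i).1 _ h))))
        simp [this]
    · exact fun h => absurd hj.1 h

variable [IsOrderedAddMonoid Γ]

theorem SuppLE.mul {f g : QTorus q Ω} {v w : G} (hf : SuppLE κ f v) (hg : SuppLE κ g w) :
    SuppLE κ (f * g) (v + w) := by
  rw [eq_sum f, eq_sum g, Finset.sum_mul_sum]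
  refine SuppLE.sum fun a ha => SuppLE.sum fun b hb => ?_
  rw [smul_mul_smul_comm, M_mul_M, smul_smul]
  refine ((suppLE_M _).smul _).mono ?_
  rw [map_add, map_add]
  exact add_le_add (hf a (mem_supp.mp ha)) (hg b (mem_supp.mp hb))

theorem coeff_mul_top (hκ : Function.Injective κ) {f g : QTorus q Ω} {v w : G}
    (hf : SuppLE κ f v) (hg : SuppLE κ g w) :
    coeff (v + w) (f * g) = coeff v f * coeff w g * ((q ^ Ω v w : Kˣ) : K) := by
  classical
  conv_lhs => rw [eq_sum f, Finset.sum_mul, map_sum]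
  simp only [smul_mul_assoc, map_smul, coeff_M_mul, smul_eq_mul]
  rw [Finset.sum_eq_single v]
  · rw [add_sub_cancel_left]; ring
  · intro u hu huv
    have h1 : κ u < κ v := lt_of_le_of_ne (hf u (mem_supp.mp hu)) fun h => huv (hκ h)
    have h2 : coeff (v + w - u) g = 0 := by
      by_contra h
      have := hg _ h
      rw [map_sub, map_add, sub_le_iff_le_add, add_comm, add_le_add_iff_left] at this
      exact absurd this (not_le.mpr h1)
    simp [h2]
  · intro hv
    rw [mem_supp, not_not] at hv
    simp [hv]

theorem IsLead.mul (hκ : Function.Injective κ) {f g : QTorus q Ω} {v w : G}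
    (hf : IsLead κ f v) (hg : IsLead κ g w) : IsLead κ (f * g) (v + w) := by
  refine ⟨hf.1.mul hg.1, ?_⟩
  rw [coeff_mul_top hκ hf.1 hg.1]
  exact mul_ne_zero (mul_ne_zero hf.2 hg.2) (Units.ne_zero _)

theorem IsLead.pow (hκ : Function.Injective κ) {f : QTorus q Ω} {v : G}
    (hf : IsLead κ f v) (n : ℕ) : IsLead κ (f ^ n) (n • v) := by
  induction n with
  | zero => rw [pow_zero, zero_smul]; exact IsLead.one
  | succ n ih => rw [pow_succ, succ_nsmul]; exact ih.mul hκ hf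

end Lead

end QTorus

end QuantumTorus

section TorusDerivations

namespace QTorus

variable {K : Type*} [Field K] {G : Type*} [AddCommGroup G] {q : Kˣ} {Ω : G →+ G →+ ℤ}

/-! ### Central exponents and derivations of a quantum torus -/

variable (Ω) in
/-- The exponent `w` lies in the radical of the commutation form, so that `M w` is central. -/
def IsCentral (w : G) : Prop := ∀ v, β Ω w v = 0

/-- All exponents of `f` are central. -/
def CentralSupp (f : QTorus q Ω) : Prop := ∀ v, coeff v f ≠ 0 → IsCentral Ω v

theorem IsCentral.M_commute {w : G} (hw : IsCentral Ω w) (f : QTorus q Ω) :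
    M q Ω w * f = f * M q Ω w := by
  induction f using induction with
  | h0 => simp
  | hadd f g hf hg => rw [mul_add, add_mul, hf, hg]
  | hM c v => rw [mul_smul_comm, smul_mul_assoc, M_comm, hw, zpow_zero, Units.val_one, one_smul]

theorem CentralSupp.commute {f : QTorus q Ω} (hf : CentralSupp f) (g : QTorus q Ω) :
    f * g = g * f := by
  rw [eq_sum f, Finset.sum_mul, Finset.mul_sum]
  refine Finset.sum_congr rfl fun v hv => ?_
  rw [smul_mul_assoc, mul_smul_comm, (hf v (mem_supp.mp hv)).M_commute]

theorem CentralSupp.add {f g : QTorus q Ω} (hf : CentralSupp f) (hg : CentralSupp g) :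
    CentralSupp (f + g) := by
  intro v hv
  by_contra h
  apply hv
  rw [map_add, not_not.mp (mt (hf v) h), not_not.mp (mt (hg v) h), add_zero]

theorem CentralSupp.smul {f : QTorus q Ω} (hf : CentralSupp f) (c : K) :
    CentralSupp (c • f) := by
  intro v hv
  refine hf v fun h => hv ?_
  rw [map_smul, h, smul_zero]

theorem CentralSupp.sub {f g : QTorus q Ω} (hf : CentralSupp f) (hg : CentralSupp g) :
    CentralSupp (f - g) := by
  rw [sub_eq_add_neg, ← neg_one_smul K g]
  exact hf.add (hg.smul _)

variable (q Ω) in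
/-- The automorphism of a quantum torus given by conjugation with the monomial `M w`. -/
noncomputable def conj (w : G) : QTorus q Ω →ₗ[K] QTorus q Ω :=
  lift fun v => ((q ^ β Ω w v : Kˣ) : K) • M q Ω v

theorem coeff_conj (w v : G) (f : QTorus q Ω) :
    coeff v (conj q Ω w f) = ((q ^ β Ω w v : Kˣ) : K) * coeff v f := by
  classical
  induction f using induction with
  | h0 => simp
  | hadd f g hf hg => rw [map_add, map_add, map_add, hf, hg, mul_add]
  | hM c u =>
    simp only [map_smul, conj, lift_M, coeff_M, smul_eq_mul]
    by_cases h : u = v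
    · subst h; simp; ring
    · simp [h]

theorem M_mul_eq_conj_mul (w : G) (f : QTorus q Ω) :
    M q Ω w * f = conj q Ω w f * M q Ω w := by
  induction f using induction with
  | h0 => simp
  | hadd f g hf hg => rw [mul_add, map_add, add_mul, hf, hg]
  | hM c u =>
    rw [map_smul, conj, lift_M, mul_smul_comm, M_comm, smul_mul_assoc, smul_mul_assoc]

/-- The derivation `M v ↦ ζ v * M v` of a quantum torus, for an additive map `ζ` (which should take
central values). -/
noncomputable def diag (ζ : G →+ QTorus q Ω) : QTorus q Ω →ₗ[K] QTorus q Ω :=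
  lift fun v => ζ v * M q Ω v

theorem diag_M (ζ : G →+ QTorus q Ω) (v : G) : diag ζ (M q Ω v) = ζ v * M q Ω v := lift_M _ _

theorem diag_mul {ζ : G →+ QTorus q Ω} (hζ : ∀ v, CentralSupp (ζ v)) (f g : QTorus q Ω) :
    diag ζ (f * g) = diag ζ f * g + f * diag ζ g := by
  induction f using induction with
  | h0 => simp
  | hadd f₁ f₂ h₁ h₂ => simp only [add_mul, map_add, h₁, h₂]; abel
  | hM a v =>
    induction g using induction with
    | h0 => simp
    | hadd g₁ g₂ h₁ h₂ => simp only [mul_add, map_add, h₁, h₂]; abel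
    | hM b w =>
      simp only [smul_mul_assoc, mul_smul_comm, M_mul_M, map_smul, diag_M, map_add]
      rw [mul_assoc (ζ v), ← mul_assoc (M q Ω v), ← (hζ w).commute, mul_assoc (ζ w), M_mul_M,
        add_mul]
      simp only [mul_smul_comm, smul_add]

/-- The derivation `[x, -] + diag ζ` of a quantum torus. -/
noncomputable def torusDer (x : QTorus q Ω) (ζ : G →+ QTorus q Ω) :
    QTorus q Ω →ₗ[K] QTorus q Ω :=
  LinearMap.mulLeft K x - LinearMap.mulRight K x + diag ζ

theorem torusDer_apply (x : QTorus q Ω) (ζ : G →+ QTorus q Ω) (f : QTorus q Ω) :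
    torusDer x ζ f = x * f - f * x + diag ζ f := rfl

theorem torusDer_mul (x : QTorus q Ω) {ζ : G →+ QTorus q Ω} (hζ : ∀ v, CentralSupp (ζ v))
    (f g : QTorus q Ω) :
    torusDer x ζ (f * g) = torusDer x ζ f * g + f * torusDer x ζ g := by
  simp only [torusDer_apply, diag_mul hζ]
  noncomm_ring

/-- A derivation along an injection `φ : A → T` into a quantum torus is, on elements of `A` which
become monomials in `T`, the sum of an inner derivation of `T` and of multiplications by central
elements. Writing `D y_i = E_i y_i`, the relation `y_i y_j = q ^ β • y_j y_i` compares the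
coefficients of `E_i` and `E_j` at every noncentral exponent. -/
theorem exists_inner_add_central (hq : ∀ n : ℤ, n ≠ 0 → q ^ n ≠ 1) {A : Type*} [Ring A]
    [Algebra K A] {φ : A →ₐ[K] QTorus q Ω} (hφ : Function.Injective φ) {D : A →ₗ[K] QTorus q Ω}
    (hD : ∀ a b, D (a * b) = D a * φ b + φ a * D b) {ι : Type*} [Fintype ι] (y : ι → A)
    (c : ι → K) (hc : ∀ i, c i ≠ 0) (w : ι → G) (hy : ∀ i, φ (y i) = c i • M q Ω (w i))
    (hw : ∀ v, (∀ i, β Ω (w i) v = 0) → IsCentral Ω v) :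
    ∃ (x : QTorus q Ω) (E : ι → QTorus q Ω), (∀ i, CentralSupp (E i)) ∧
      ∀ i, D (y i) = x * φ (y i) - φ (y i) * x + E i * φ (y i) := by
  classical
  have hunit : ∀ i, IsUnit (φ (y i)) := fun i => by
    rw [hy, ← mul_one (M q Ω (w i)), ← mul_smul_comm, ← Algebra.algebraMap_eq_smul_one]
    exact (isUnit_M _).mul ((hc i).isUnit.map _)
  have hE : ∀ i, ∃ E, D (y i) = E * φ (y i) := fun i => by
    obtain ⟨u, hu⟩ := hunit i
    exact ⟨D (y i) * ↑u⁻¹, by rw [← hu, mul_assoc, Units.inv_mul, mul_one]⟩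
  choose E hE using hE
  have hconj : ∀ i f, φ (y i) * f = conj q Ω (w i) f * φ (y i) := fun i f => by
    rw [hy, smul_mul_assoc, M_mul_eq_conj_mul, mul_smul_comm]
  have hcomm : ∀ i j, y i * y j = ((q ^ β Ω (w i) (w j) : Kˣ) : K) • (y j * y i) := by
    intro i j
    apply hφ
    rw [map_smul, map_mul, map_mul, hy, hy, smul_mul_smul_comm, smul_mul_smul_comm, M_comm,
      smul_comm, mul_comm (c i)]
  have key : ∀ i j, E i - conj q Ω (w j) (E i) = E j - conj q Ω (w i) (E j) := by
    intro i j
    have h := congrArg D (hcomm i j)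
    rw [map_smul, hD, hD, hE, hE] at h
    have h2 := congrArg φ (hcomm i j)
    rw [map_smul, map_mul, map_mul] at h2
    refine ((hunit i).mul (hunit j)).mul_right_cancel ?_
    have e1 : φ (y i) * (E j * φ (y j)) = conj q Ω (w i) (E j) * (φ (y i) * φ (y j)) := by
      rw [← mul_assoc, hconj, mul_assoc]
    have e2 : φ (y j) * (E i * φ (y i)) = conj q Ω (w j) (E i) * (φ (y j) * φ (y i)) := by
      rw [← mul_assoc, hconj, mul_assoc]
    rw [e1, e2, mul_assoc, mul_assoc, smul_add, ← mul_smul_comm, ← h2, ← mul_smul_comm,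
      ← h2] at h
    rw [sub_mul, sub_mul, sub_eq_sub_iff_add_eq_add, h]
  have key' : ∀ i j v, coeff v (E i) * (1 - ((q ^ β Ω (w j) v : Kˣ) : K)) =
      coeff v (E j) * (1 - ((q ^ β Ω (w i) v : Kˣ) : K)) := by
    intro i j v
    have h := congrArg (coeff v) (key i j)
    rw [map_sub, map_sub, coeff_conj, coeff_conj] at h
    linear_combination h
  have hne : ∀ i v, β Ω (w i) v ≠ 0 → 1 - ((q ^ β Ω (w i) v : Kˣ) : K) ≠ 0 := by
    intro i v h h0
    exact hq _ h (Units.ext (by rw [Units.val_one]; exact (sub_eq_zero.mp h0).symm))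
  let F : G → K := fun v => if h : ∃ i, β Ω (w i) v ≠ 0 then
    coeff v (E h.choose) / (1 - ((q ^ β Ω (w h.choose) v : Kˣ) : K)) else 0
  have hF : ∀ v i, (∃ i, β Ω (w i) v ≠ 0) →
      F v * (1 - ((q ^ β Ω (w i) v : Kˣ) : K)) = coeff v (E i) := by
    intro v i h
    simp only [F, dif_pos h]
    have := hne _ v h.choose_spec
    rw [div_mul_eq_mul_div, div_eq_iff this, key']
  let x : QTorus q Ω := Finsupp.onFinset (Finset.univ.biUnion fun i => supp (E i)) F (by
    intro v hv
    simp only [F] at hv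
    split_ifs at hv with h
    · refine Finset.mem_biUnion.mpr ⟨h.choose, Finset.mem_univ _, mem_supp.mpr fun h0 => hv ?_⟩
      rw [h0, zero_div]
    · exact absurd rfl hv)
  have hx : ∀ v, coeff v x = F v := fun v => rfl
  refine ⟨x, fun i => E i - (x - conj q Ω (w i) x), fun i v hv => hw v ?_, fun i => ?_⟩
  · by_contra h
    push Not at h
    apply hv
    rw [map_sub, map_sub, coeff_conj, hx, ← hF v i h]
    ring
  · rw [hE, hconj, sub_mul, sub_mul]
    abel

/-! ### Exchange relations and the Laurent property -/

/-- Two sequences indexed by `ℤ`, finitely supported and equal off `0`, such that `a` vanishes at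
`n - 1` exactly if `b` does at `n`, both vanish at `0`: propagate zeros from `∞` down to `a 0`, and
from `-∞` up to `b 0`. -/
theorem eq_zero_of_recursion {a b : ℤ → K} (hab : ∀ n, a (n - 1) = 0 ↔ b n = 0)
    (hne : ∀ n, n ≠ 0 → a n = b n) (hfin : {n | a n ≠ 0}.Finite) : a 0 = 0 ∧ b 0 = 0 := by
  obtain ⟨N, hN⟩ := hfin.bddAbove
  obtain ⟨N', hN'⟩ := hfin.bddBelow
  have up : ∀ n, N < n → a n = 0 := fun n hn => by
    by_contra h; exact absurd (hN h) (not_le.mpr hn)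
  have dn : ∀ n, n < N' → a n = 0 := fun n hn => by
    by_contra h; exact absurd (hN' h) (not_le.mpr hn)
  constructor
  · have : ∀ k : ℕ, 0 ≤ N + 1 - k → a (N + 1 - k) = 0 := by
      intro k
      induction k with
      | zero => intro _; exact up _ (by simp)
      | succ k ih =>
        intro hk
        push_cast at hk ⊢
        have h1 := ih (by omega)
        rw [hne _ (by omega), ← hab] at h1
        rwa [show N + 1 - (k + 1 : ℤ) = N + 1 - k - 1 by ring]
    by_cases h : 0 ≤ N + 1
    · have := this (N + 1).toNat (by omega)
      rwa [show N + 1 - ((N + 1).toNat : ℤ) = 0 by omega] at this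
    · exact up 0 (by omega)
  · have : ∀ k : ℕ, N' + k ≤ 0 → b (N' + k) = 0 := by
      intro k
      induction k with
      | zero => intro _; rw [← hab]; exact dn _ (by simp)
      | succ k ih =>
        intro hk
        push_cast at hk ⊢
        have h1 := ih (by omega)
        rw [← hne _ (by omega)] at h1
        rw [← hab]
        rwa [show N' + (k + 1 : ℤ) - 1 = N' + k by ring]
    by_cases h : N' ≤ 0
    · have := this (-N').toNat (by omega)
      rwa [show N' + ((-N').toNat : ℤ) = 0 by omega] at this
    · rw [← hab]; exact dn _ (by omega)

variable {deg : G →+ ℤ}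

variable (deg) in
/-- Let `deg` be the exponent of one cluster variable and let `Q`, homogeneous of degree `-1`, be
the variable obtained from it by mutation. The span of the products `M v * Q ^ n` with
`0 ≤ deg v` is the set of elements which remain Laurent polynomials after the mutation. -/
noncomputable def mutSpan (Q : QTorus q Ω) : Submodule K (QTorus q Ω) :=
  Submodule.span K {f | ∃ v n, 0 ≤ deg v ∧ f = M q Ω v * Q ^ n}

theorem mul_mem_mutSpan_of_gen {Q g : QTorus q Ω}
    (hg : ∀ v (n : ℕ), 0 ≤ deg v → g * (M q Ω v * Q ^ n) ∈ mutSpan deg Q) {f : QTorus q Ω}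
    (hf : f ∈ mutSpan deg Q) : g * f ∈ mutSpan deg Q := by
  induction hf using Submodule.span_induction with
  | mem f hf => obtain ⟨v, n, hv, rfl⟩ := hf; exact hg v n hv
  | zero => rw [mul_zero]; exact zero_mem _
  | add f₁ f₂ _ _ h₁ h₂ => rw [mul_add]; exact add_mem h₁ h₂
  | smul c f _ h => rw [mul_smul_comm]; exact Submodule.smul_mem _ _ h

theorem M_mul_mem_mutSpan {Q : QTorus q Ω} {w : G} (hw : 0 ≤ deg w) {f : QTorus q Ω}
    (hf : f ∈ mutSpan deg Q) : M q Ω w * f ∈ mutSpan deg Q := by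
  refine mul_mem_mutSpan_of_gen (fun v n hv => ?_) hf
  rw [← mul_assoc, M_mul_M, smul_mul_assoc]
  exact Submodule.smul_mem _ _ (Submodule.subset_span ⟨w + v, n, by rw [map_add]; omega, rfl⟩)

section Mutation

variable {p p' : G}

/-- In degree `0`, the two monomials of `Q` have the same commutation factor with `M v`, so that `Q`
moves past `M v`; in positive degree, the monomials of `Q` are absorbed by `M v`. -/
theorem Q_mul_mem_mutSpan (hp : deg p = -1) (hp' : deg p' = -1) {k : ℤ}
    (hk : ∀ v, β Ω (p - p') v = k * deg v) (a a' : K) {f : QTorus q Ω}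
    (hf : f ∈ mutSpan deg (a • M q Ω p + a' • M q Ω p')) :
    (a • M q Ω p + a' • M q Ω p') * f ∈ mutSpan deg (a • M q Ω p + a' • M q Ω p') := by
  refine mul_mem_mutSpan_of_gen (fun v n hv => ?_) hf
  rw [← mul_assoc]
  rcases hv.eq_or_lt with h0 | hpos
  · have e : β Ω p v = β Ω p' v := by
      have := hk v
      rw [← h0, mul_zero, β_sub_left] at this
      omega
    rw [add_mul, smul_mul_assoc, smul_mul_assoc, M_comm p, M_comm p', e, smul_comm a,
      smul_comm a', ← smul_add, ← mul_smul_comm, ← mul_smul_comm, ← mul_add, smul_mul_assoc,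
      mul_assoc, ← pow_succ']
    exact Submodule.smul_mem _ _ (Submodule.subset_span ⟨v, n + 1, hv, rfl⟩)
  · simp only [add_mul, smul_mul_assoc, M_mul_M]
    refine add_mem ?_ ?_ <;>
    refine Submodule.smul_mem _ _ (Submodule.smul_mem _ _ (Submodule.subset_span
      ⟨_, n, ?_, rfl⟩)) <;> rw [map_add] <;> omega

/-- The part of degree `-1` of an element of `mutSpan deg Q` is a left multiple of `Q`. -/
theorem exists_coeff_eq_mul_Q (a a' : K) {f : QTorus q Ω}
    (hf : f ∈ mutSpan deg (a • M q Ω p + a' • M q Ω p')) :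
    ∃ r, ∀ v, deg v = -1 → coeff v f = coeff v (r * (a • M q Ω p + a' • M q Ω p')) := by
  classical
  induction hf using Submodule.span_induction with
  | mem f hf =>
    obtain ⟨w, n, hw, rfl⟩ := hf
    rcases n with _ | n
    · refine ⟨0, fun v hv => ?_⟩
      rw [pow_zero, mul_one, zero_mul, map_zero, coeff_M, if_neg]
      rintro rfl
      omega
    · exact ⟨M q Ω w * _ ^ n, fun v _ => by rw [mul_assoc, ← pow_succ]⟩
  | zero => exact ⟨0, fun v _ => by simp⟩
  | add f₁ f₂ _ _ h₁ h₂ =>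
    obtain ⟨r₁, h₁⟩ := h₁
    obtain ⟨r₂, h₂⟩ := h₂
    exact ⟨r₁ + r₂, fun v hv => by rw [map_add, h₁ v hv, h₂ v hv, add_mul, map_add]⟩
  | smul c f _ h =>
    obtain ⟨r, h⟩ := h
    exact ⟨c • r, fun v hv => by rw [map_smul, h v hv, smul_mul_assoc, map_smul]⟩

/-- If the derivation `[x, -] + diag ζ` maps the mutated cluster variable `Q` into `mutSpan deg Q`,
then `ζ` takes the same value on the two exponents of `Q`. For a central exponent `z`, this compares
the coefficients on the line `z + p' + ℤ (p - p')`, where finiteness of supports forces all but two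
of them to vanish. -/
theorem eq_of_torusDer_mem_mutSpan (hp : deg p = -1) (hp' : deg p' = -1) {k : ℤ}
    (hk : ∀ v, β Ω (p - p') v = k * deg v) (a a' : K) (hk0 : k ≠ 0) (ha : a ≠ 0) (ha' : a' ≠ 0)
    (x : QTorus q Ω)
    {ζ : G →+ QTorus q Ω} (hζ : ∀ v, CentralSupp (ζ v))
    (h : torusDer x ζ (a • M q Ω p + a' • M q Ω p') ∈
      mutSpan deg (a • M q Ω p + a' • M q Ω p')) : ζ p = ζ p' := by
  refine ext fun z => ?_
  by_cases hz : IsCentral Ω z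
  swap
  · rw [not_not.mp (mt (hζ p z) hz), not_not.mp (mt (hζ p' z) hz)]
  obtain ⟨r, hr⟩ := exists_coeff_eq_mul_Q a a' h
  set s := p - p' with hs
  have hsdeg : deg s = 0 := by rw [hs, map_sub, hp, hp']; rfl
  have hzdeg : deg z = 0 := by
    have h1 := hk z
    rw [β_swap, hz, neg_zero] at h1
    exact (mul_eq_zero.mp h1.symm).resolve_left hk0
  have hps : ∀ n : ℤ, β Ω p (z + n • s) = n * k := by
    intro n
    rw [β_add_right, β_swap p z, hz, β_zsmul_right, β_swap, hk, hp]; ring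
  have hps' : ∀ n : ℤ, β Ω p' (z + n • s) = n * k := by
    intro n
    rw [β_add_right, β_swap p' z, hz, β_zsmul_right, β_swap, hk, hp']; ring
  have hcent : ∀ n : ℤ, n ≠ 0 → ¬ IsCentral Ω (z + n • s) := by
    intro n hn hc
    have h1 := hc p
    rw [β_swap, hps, neg_eq_zero] at h1
    exact (mul_ne_zero hn hk0) h1
  have hinj : Function.Injective fun n : ℤ => z + n • s := by
    intro m n hmn
    have h1 := hps m
    rw [show z + m • s = z + n • s from hmn, hps] at h1
    exact (mul_right_cancel₀ hk0 h1).symm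
  let g : ℤ → K := fun n => coeff (z + n • s) (r - (x - conj q Ω p x))
  let u : ℤ → K := fun n => g n - coeff (z + n • s) (ζ p)
  let u' : ℤ → K := fun n => g n - coeff (z + n • s) (ζ p')
  have hrec : ∀ n, a * ((q ^ Ω (z + (n - 1) • s) p : Kˣ) : K) * u (n - 1) +
      a' * ((q ^ Ω (z + n • s) p' : Kˣ) : K) * u' n = 0 := by
    intro n
    have h1 := hr (z + n • s + p') (by rw [map_add, map_add, map_zsmul, hsdeg, hzdeg, hp']; simp)
    have e1 : z + n • s + p' - p = z + (n - 1) • s := by rw [sub_smul, one_smul, hs]; abel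
    have e2 : z + n • s + p' - p' = z + n • s := by abel
    rw [torusDer_apply] at h1
    simp only [mul_add, add_mul, map_add, map_sub, map_smul, smul_mul_assoc, mul_smul_comm,
      diag_M, M_mul_eq_conj_mul, coeff_mul_M, e1, e2, smul_eq_mul, coeff_conj, hps'] at h1
    rw [hps] at h1
    simp only [u, u', g, map_sub, map_add, coeff_conj, hps]
    linear_combination -h1
  have h0 := eq_zero_of_recursion (a := u) (b := u') (fun n => ?_) (fun n hn => ?_) ?_
  · have := h0.1.trans h0.2.symm
    simpa [u, u'] using this
  · have hA := mul_ne_zero ha (Units.ne_zero (q ^ Ω (z + (n - 1) • s) p))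
    have hA' := mul_ne_zero ha' (Units.ne_zero (q ^ Ω (z + n • s) p'))
    have := hrec n
    constructor
    · intro h; rw [h, mul_zero, zero_add] at this; exact (mul_eq_zero.mp this).resolve_left hA'
    · intro h; rw [h, mul_zero, add_zero] at this; exact (mul_eq_zero.mp this).resolve_left hA
  · simp only [u, u', not_not.mp (mt (hζ p _) (hcent n hn)), not_not.mp (mt (hζ p' _) (hcent n hn))]
  · refine Set.Finite.subset (Set.Finite.preimage hinj.injOn
      (supp (r - (x - conj q Ω p x) - ζ p)).finite_toSet) fun n hn => ?_
    simp only [Set.mem_preimage, Finset.mem_coe, mem_supp]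
    rwa [map_sub]

end Mutation

end QTorus

end TorusDerivations

open QTorus

/-! ### The embedding into a quantum torus of rank six -/

section Embedding

variable {K : Type*} [Field K]

/-- The bilinear form of the quantum torus with generators `t_1, …, t_6` and relations
`t_i t_j = q ^ b_ij t_j t_i`, where `X_i X_j = q ^ b_ij X_j X_i + …` for the PBW generators and
`i < j`; the monomial with exponent `v` is `t_1 ^ v_1 ⋯ t_6 ^ v_6` in this order. -/
def Om : (Fin 6 → ℤ) →+ (Fin 6 → ℤ) →+ ℤ :=
  AddMonoidHom.mk' (fun v => AddMonoidHom.mk' (fun w =>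
    w 0 * (-v 1 - v 2 + v 3 + v 4) + w 1 * (-v 2 - v 3 + v 5) + w 2 * (-v 4 - v 5)
      + w 3 * (-v 4 + v 5) - w 4 * v 5)
    (fun w w' => by simp only [Pi.add_apply]; ring))
    (fun v v' => AddMonoidHom.ext fun w => by
      simp only [Pi.add_apply, AddMonoidHom.mk'_apply, AddMonoidHom.add_apply]; ring)

theorem Om_apply (v w : Fin 6 → ℤ) : Om v w =
    w 0 * (-v 1 - v 2 + v 3 + v 4) + w 1 * (-v 2 - v 3 + v 5) + w 2 * (-v 4 - v 5)
      + w 3 * (-v 4 + v 5) - w 4 * v 5 := rfl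

theorem mon_mul_mon (q : Kˣ) (a b c d e f a' b' c' d' e' f' : ℤ) :
    M q Om ![a, b, c, d, e, f] * M q Om ![a', b', c', d', e', f'] =
      (q : K) ^ (a' * (-b - c + d + e) + b' * (-c - d + f) + c' * (-e - f)
      + d' * (-e + f) - e' * f) • M q Om ![a + a', b + b', c + c', d + d', e + e', f + f'] := by
  rw [M_mul_M, Units.val_zpow_eq_zpow_val]
  congr 2
  ext i
  fin_cases i <;> rfl

/-- The images of the Chevalley generators. -/
noncomputable def eT (q : Kˣ) : Fin 3 → QTorus q Om :=
  ![M q Om ![1, 0, 0, 0, 0, 0],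
    M q Om ![0, 0, 0, 1, 0, 0] + M q Om ![-1, 1, 0, 0, 0, 0],
    M q Om ![0, 0, 0, 0, 0, 1] + M q Om ![0, 0, 0, -1, 1, 0] + M q Om ![0, -1, 1, 0, 0, 0]]

theorem eT_comm (q : Kˣ) : eT q 0 * eT q 2 - eT q 2 * eT q 0 = 0 := by
  simp [eT, mul_add, add_mul, mon_mul_mon]

theorem eT_serre (q : Kˣ) (i j : Fin 3) (hij : |((i : ℕ) : ℤ) - ((j : ℕ) : ℤ)| = 1) :
    eT q i ^ 2 * eT q j - ((q : K) + (q : K)⁻¹) • (eT q i * eT q j * eT q i)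
      + eT q j * eT q i ^ 2 = 0 := by
  have hq : (q : K) ≠ 0 := q.ne_zero
  fin_cases i <;> fin_cases j <;> simp at hij <;>
  · simp only [eT, Fin.isValue, Fin.mk_one, Fin.zero_eta, Fin.reduceFinMk, Matrix.cons_val,
      pow_two, mul_add, add_mul, mon_mul_mon, smul_mul_assoc, mul_smul_comm]
    norm_num
    match_scalars <;> field_simp <;> ring

/-- The homomorphism from `U_q(sl_4^+)` to a quantum torus of rank six, mapping `e_i` to a sum of
`i` monomials. -/
noncomputable def toTorus (q : Kˣ) : Uq K (q : K) →ₐ[K] QTorus q Om :=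
  RingQuot.liftAlgHom K ⟨FreeAlgebra.lift K (eT q), fun x y h => by
    induction h with
    | comm =>
      simpa only [map_sub, map_mul, map_zero, FreeAlgebra.lift_ι_apply] using eT_comm q
    | serre i j hij =>
      simpa only [map_add, map_sub, map_mul, map_zero, map_smul, map_pow,
        FreeAlgebra.lift_ι_apply] using eT_serre q i j hij⟩

theorem toTorus_e (q : Kˣ) (i : Fin 3) : toTorus q (e K (q : K) i) = eT q i := by
  have h : toTorus q (e K (q : K) i) = FreeAlgebra.lift K (eT q) (FreeAlgebra.ι K i) :=
    RingQuot.liftAlgHom_mkAlgHom_apply K _ _ _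
  rw [h, FreeAlgebra.lift_ι_apply]

variable (K) in
/-- The root vector of the root `α_1 + α_2` opposite to `X_2`; up to a scalar, its image in the
quantum torus is `t_1 t_4`. -/
def X2op (q : K) : Uq K q := e K q 1 * e K q 0 - q⁻¹ • (e K q 0 * e K q 1)

variable (K) in
/-- The cluster variable obtained by mutation at `X_2`. -/
def mutX2 (q : K) : Uq K q := X5 K q * X1 K q - q⁻¹ • (X1 K q * X5 K q)

variable (K) in
/-- The cluster variable obtained by mutation at `X2op`. -/
def mutX2op (q : K) : Uq K q := X6 K q * X2 K q - q⁻¹ • (X2 K q * X6 K q)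

theorem toTorus_X1 (q : Kˣ) : toTorus q (X1 K q) = M q Om ![1, 0, 0, 0, 0, 0] := by
  rw [X1, toTorus_e, eT]; rfl

theorem toTorus_X4 (q : Kˣ) : toTorus q (X4 K q) =
    M q Om ![0, 0, 0, 1, 0, 0] + M q Om ![-1, 1, 0, 0, 0, 0] := by
  rw [X4, toTorus_e, eT]; rfl

theorem toTorus_X6 (q : Kˣ) : toTorus q (X6 K q) =
    M q Om ![0, 0, 0, 0, 0, 1] + M q Om ![0, 0, 0, -1, 1, 0] + M q Om ![0, -1, 1, 0, 0, 0] := by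
  rw [X6, toTorus_e, eT]; rfl

theorem toTorus_X2 (q : Kˣ) : toTorus q (X2 K q) =
    (1 - (q : K)⁻¹ ^ 2) • M q Om ![0, 1, 0, 0, 0, 0] := by
  have hq : (q : K) ≠ 0 := q.ne_zero
  change toTorus q (X1 K q * X4 K q - _ • (X4 K q * X1 K q)) = _
  simp only [map_sub, map_mul, map_smul, toTorus_X1, toTorus_X4, mul_add, add_mul, mon_mul_mon]
  norm_num
  match_scalars; field_simp

theorem toTorus_X2op (q : Kˣ) : toTorus q (X2op K q) =
    ((q : K) - (q : K)⁻¹) • M q Om ![1, 0, 0, 1, 0, 0] := by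
  have hq : (q : K) ≠ 0 := q.ne_zero
  change toTorus q (X4 K q * X1 K q - _ • (X1 K q * X4 K q)) = _
  simp only [map_sub, map_mul, map_smul, toTorus_X1, toTorus_X4, mul_add, add_mul, mon_mul_mon]
  norm_num
  match_scalars; field_simp

theorem toTorus_X5 (q : Kˣ) : toTorus q (X5 K q) =
    (1 - (q : K)⁻¹ ^ 2) • (M q Om ![0, 0, 0, 0, 1, 0] + (q : K) • M q Om ![0, -1, 1, 1, 0, 0]
      + M q Om ![-1, 0, 1, 0, 0, 0]) := by
  have hq : (q : K) ≠ 0 := q.ne_zero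
  change toTorus q (X4 K q * X6 K q - _ • (X6 K q * X4 K q)) = _
  simp only [map_sub, map_mul, map_smul, toTorus_X4, toTorus_X6, mul_add, add_mul, mon_mul_mon]
  norm_num
  match_scalars <;> field_simp <;> ring

theorem toTorus_X3 (q : Kˣ) : toTorus q (X3 K q) =
    (1 - (q : K)⁻¹ ^ 2) ^ 2 • M q Om ![0, 0, 1, 0, 0, 0] := by
  have hq : (q : K) ≠ 0 := q.ne_zero
  change toTorus q (X1 K q * X5 K q - _ • (X5 K q * X1 K q)) = _
  simp only [map_sub, map_mul, map_smul, toTorus_X1, toTorus_X5, mul_add, add_mul, mon_mul_mon,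
    mul_smul_comm, smul_mul_assoc]
  norm_num
  match_scalars <;> field_simp <;> ring

theorem toTorus_mutX2 (q : Kˣ) : toTorus q (mutX2 K q) =
    (((q : K) - (q : K)⁻¹) * (1 - (q : K)⁻¹ ^ 2)) • M q Om ![1, 0, 0, 0, 1, 0]
      + (((q : K) - (q : K)⁻¹) * (1 - (q : K)⁻¹ ^ 2) * q) • M q Om ![1, -1, 1, 1, 0, 0] := by
  have hq : (q : K) ≠ 0 := q.ne_zero
  simp only [mutX2, map_sub, map_mul, map_smul, toTorus_X1, toTorus_X5, mul_add, add_mul,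
    mon_mul_mon, mul_smul_comm, smul_mul_assoc]
  norm_num
  match_scalars <;> field_simp; ring

theorem toTorus_mutX2op (q : Kˣ) : toTorus q (mutX2op K q) =
    (((q : K) - (q : K)⁻¹) * (1 - (q : K)⁻¹ ^ 2)) • M q Om ![0, 1, 0, 0, 0, 1]
      + (((q : K) - (q : K)⁻¹) * (1 - (q : K)⁻¹ ^ 2)) • M q Om ![0, 1, 0, -1, 1, 0] := by
  have hq : (q : K) ≠ 0 := q.ne_zero
  simp only [mutX2op, map_sub, map_mul, map_smul, toTorus_X2, toTorus_X6, mul_add, add_mul,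
    mon_mul_mon, mul_smul_comm, smul_mul_assoc]
  norm_num
  match_scalars <;> field_simp; ring

theorem toTorus_Δ2 (q : Kˣ) : toTorus q (Δ2 K q) =
    (1 - (q : K)⁻¹ ^ 2) ^ 2 • M q Om ![0, 1, 0, 0, 1, 0] := by
  have hq : (q : K) ≠ 0 := q.ne_zero
  simp only [Δ2, map_sub, map_mul, map_smul, toTorus_X2, toTorus_X5, toTorus_X3, toTorus_X4,
    mul_add, mon_mul_mon, mul_smul_comm, smul_mul_assoc]
  norm_num
  match_scalars <;> field_simp <;> ring

theorem toTorus_Δ3 (q : Kˣ) : toTorus q (Δ3 K q) =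
    ((q : K) - (q : K)⁻¹) ^ 2 • M q Om ![1, 0, 0, 1, 0, 1] := by
  have hq : (q : K) ≠ 0 := q.ne_zero
  simp only [Δ3, map_sub, map_add, map_mul, map_smul, toTorus_X1, toTorus_X2, toTorus_X3,
    toTorus_X4, toTorus_X5, toTorus_X6, mul_add, add_mul, mon_mul_mon, mul_smul_comm,
    smul_mul_assoc]
  norm_num
  match_scalars <;> field_simp <;> ring

theorem toTorus_z1 (q : Kˣ) : toTorus q (z1 K q) =
    (((q : K) - (q : K)⁻¹) ^ 2 * (1 - (q : K)⁻¹ ^ 2) ^ 2 * (q : K)⁻¹) •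
      M q Om ![1, 0, 1, 1, 0, 1] := by
  have hq : (q : K) ≠ 0 := q.ne_zero
  simp only [z1, Δ1, map_mul, toTorus_X3, toTorus_Δ3, mon_mul_mon, mul_smul_comm, smul_mul_assoc]
  norm_num
  match_scalars; field_simp

end Embedding

/-! ### The PBW generators span -/

section QCommutators

variable {K : Type*} [Field K] {A : Type*} [Ring A] [Algebra K A] {q : K}

theorem mul_qcomm_of_serre (hq : q ≠ 0) {a b : A}
    (h : a ^ 2 * b - (q + q⁻¹) • (a * b * a) + b * a ^ 2 = 0) :
    a * (a * b - q⁻¹ • (b * a)) = q • ((a * b - q⁻¹ • (b * a)) * a) := by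
  rw [← sub_eq_zero, ← h]
  simp only [pow_two, mul_sub, sub_mul, mul_smul_comm, smul_mul_assoc, ← mul_assoc]
  match_scalars <;> field_simp; ring

theorem qcomm_mul_of_serre (hq : q ≠ 0) {a b : A}
    (h : b ^ 2 * a - (q + q⁻¹) • (b * a * b) + a * b ^ 2 = 0) :
    (a * b - q⁻¹ • (b * a)) * b = q • (b * (a * b - q⁻¹ • (b * a))) := by
  rw [← sub_eq_zero, ← h]
  simp only [pow_two, mul_sub, sub_mul, mul_smul_comm, smul_mul_assoc, ← mul_assoc]
  match_scalars <;> field_simp; ring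

/-- An element that commutes up to scalars with `a` and `b` also does with their `q`-commutator. -/
theorem mul_qcomm {a b c : A} {r s t : K} (ha : c * a = s • (a * c)) (hb : c * b = t • (b * c)) :
    c * (a * b - r • (b * a)) = (s * t) • ((a * b - r • (b * a)) * c) := by
  have e1 : c * a * b = (s * t) • (a * b * c) := by
    rw [ha, smul_mul_assoc, mul_assoc, hb, mul_smul_comm, smul_smul, mul_assoc]
  have e2 : c * b * a = (s * t) • (b * a * c) := by
    rw [hb, smul_mul_assoc, mul_assoc, ha, mul_smul_comm, smul_smul, mul_assoc, mul_comm s]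
  simp only [mul_sub, sub_mul, mul_smul_comm, smul_mul_assoc, ← mul_assoc, e1, e2]
  module

end QCommutators

section Straightening

variable {K : Type*} [Field K] {q : K}

theorem e_serre' (i j : Fin 3) (hij : |((i : ℕ) : ℤ) - ((j : ℕ) : ℤ)| = 1 := by simp) :
    e K q i ^ 2 * e K q j - (q + q⁻¹) • (e K q i * e K q j * e K q i)
      + e K q j * e K q i ^ 2 = 0 := e_serre K q i j hij

theorem X6_mul_X1 : X6 K q * X1 K q = X1 K q * X6 K q := (sub_eq_zero.mp (e_comm K q)).symm

theorem X4_mul_X1 (hq : q ≠ 0) : X4 K q * X1 K q = q • (X1 K q * X4 K q) - q • X2 K q := by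
  simp only [X1, X2, X4]
  match_scalars <;> field_simp; ring

theorem X6_mul_X4 (hq : q ≠ 0) : X6 K q * X4 K q = q • (X4 K q * X6 K q) - q • X5 K q := by
  simp only [X4, X5, X6]
  match_scalars <;> field_simp; ring

theorem X5_mul_X1 (hq : q ≠ 0) : X5 K q * X1 K q = q • (X1 K q * X5 K q) - q • X3 K q := by
  simp only [X3, X1]
  match_scalars <;> field_simp; ring

theorem X1_mul_X2 (hq : q ≠ 0) : X1 K q * X2 K q = q • (X2 K q * X1 K q) :=
  mul_qcomm_of_serre hq (e_serre' 0 1)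

theorem X2_mul_X4 (hq : q ≠ 0) : X2 K q * X4 K q = q • (X4 K q * X2 K q) :=
  qcomm_mul_of_serre hq (e_serre' 1 0)

theorem X4_mul_X5 (hq : q ≠ 0) : X4 K q * X5 K q = q • (X5 K q * X4 K q) :=
  mul_qcomm_of_serre hq (e_serre' 1 2)

theorem X5_mul_X6 (hq : q ≠ 0) : X5 K q * X6 K q = q • (X6 K q * X5 K q) :=
  qcomm_mul_of_serre hq (e_serre' 2 1)

theorem X3_eq : X3 K q = X2 K q * X6 K q - q⁻¹ • (X6 K q * X2 K q) := by
  have h : e K q 0 * e K q 2 = e K q 2 * e K q 0 := sub_eq_zero.mp (e_comm K q)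
  have h1 : e K q 0 * e K q 2 * e K q 1 = e K q 2 * e K q 0 * e K q 1 := by rw [h]
  have h2 : e K q 1 * e K q 0 * e K q 2 = e K q 1 * e K q 2 * e K q 0 := by
    rw [mul_assoc, h, mul_assoc]
  simp only [X2, X3, X5, X6, mul_sub, sub_mul, mul_smul_comm, smul_mul_assoc, ← mul_assoc, h1, h2]
  module

theorem X6_mul_X2 (hq : q ≠ 0) : X6 K q * X2 K q = q • (X2 K q * X6 K q) - q • X3 K q := by
  rw [X3_eq]
  match_scalars <;> field_simp; ring

theorem X1_mul_X3 (hq : q ≠ 0) : X1 K q * X3 K q = q • (X3 K q * X1 K q) := by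
  rw [X3_eq]
  simpa using mul_qcomm (r := q⁻¹) (X1_mul_X2 hq)
    (by rw [X6_mul_X1, one_smul] : X1 K q * X6 K q = (1 : K) • (X6 K q * X1 K q))

theorem X6_mul_X3 (hq : q ≠ 0) : X6 K q * X3 K q = q⁻¹ • (X3 K q * X6 K q) := by
  have h : X6 K q * X5 K q = q⁻¹ • (X5 K q * X6 K q) := by
    rw [X5_mul_X6 hq, smul_smul, inv_mul_cancel₀ hq, one_smul]
  have := mul_qcomm (r := q⁻¹) (by rw [X6_mul_X1, one_smul] :
    X6 K q * X1 K q = (1 : K) • (X1 K q * X6 K q)) h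
  rwa [one_mul] at this

/-- With `X_3 = [X_1, X_5]_q`; together with `X3_mul_X4_eq_sub_commutator`, it shows that `X_3` and
`X_4` commute, as `1 + q ^ 2 ≠ 0`. -/
theorem X4_mul_X3_eq_sub_commutator (hq : q ≠ 0) :
    X4 K q * X3 K q = q ^ 2 • (X3 K q * X4 K q) - q • (X2 K q * X5 K q - X5 K q * X2 K q) := by
  have e1 : X4 K q * X1 K q * X5 K q =
      q ^ 2 • (X1 K q * X5 K q * X4 K q) - q • (X2 K q * X5 K q) := by
    rw [X4_mul_X1 hq, sub_mul, smul_mul_assoc, smul_mul_assoc, mul_assoc, X4_mul_X5 hq,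
      mul_smul_comm, smul_smul, pow_two, mul_assoc]
  have e2 : X4 K q * X5 K q * X1 K q =
      q ^ 2 • (X5 K q * X1 K q * X4 K q) - q ^ 2 • (X5 K q * X2 K q) := by
    rw [X4_mul_X5 hq, smul_mul_assoc, mul_assoc, X4_mul_X1 hq, mul_sub, mul_smul_comm,
      mul_smul_comm, smul_sub, smul_smul, smul_smul, pow_two, mul_assoc]
  change X4 K q * (X1 K q * X5 K q - q⁻¹ • (X5 K q * X1 K q)) =
    q ^ 2 • ((X1 K q * X5 K q - q⁻¹ • (X5 K q * X1 K q)) * X4 K q) - _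
  simp only [mul_sub, sub_mul, mul_smul_comm, smul_mul_assoc, ← mul_assoc, e1, e2]
  match_scalars <;> field_simp

/-- With `X_3 = [X_2, X_6]_q`. -/
theorem X3_mul_X4_eq_sub_commutator (hq : q ≠ 0) :
    X3 K q * X4 K q = q ^ 2 • (X4 K q * X3 K q) - q • (X2 K q * X5 K q - X5 K q * X2 K q) := by
  have e1 : X2 K q * X6 K q * X4 K q =
      q ^ 2 • (X4 K q * X2 K q * X6 K q) - q • (X2 K q * X5 K q) := by
    rw [mul_assoc, X6_mul_X4 hq, mul_sub, mul_smul_comm, mul_smul_comm, ← mul_assoc,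
      X2_mul_X4 hq, smul_mul_assoc, smul_smul, pow_two]
  have e2 : X6 K q * X2 K q * X4 K q =
      q ^ 2 • (X4 K q * X6 K q * X2 K q) - q ^ 2 • (X5 K q * X2 K q) := by
    rw [mul_assoc, X2_mul_X4 hq, mul_smul_comm, ← mul_assoc, X6_mul_X4 hq, sub_mul,
      smul_mul_assoc, smul_mul_assoc, smul_sub, smul_smul, smul_smul, pow_two]
  simp only [X3_eq, mul_sub, sub_mul, mul_smul_comm, smul_mul_assoc, ← mul_assoc, e1, e2]
  match_scalars <;> field_simp

theorem X4_mul_X3 (hq : q ≠ 0) (hq2 : 1 + q ^ 2 ≠ 0) :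
    X4 K q * X3 K q = X3 K q * X4 K q := by
  have h1 := X4_mul_X3_eq_sub_commutator (K := K) hq
  have h2 := X3_mul_X4_eq_sub_commutator (K := K) hq
  have h : (1 + q ^ 2) • (X4 K q * X3 K q - X3 K q * X4 K q) = 0 := by
    have h3 : X4 K q * X3 K q - X3 K q * X4 K q =
      (q ^ 2 • (X3 K q * X4 K q) - q • (X2 K q * X5 K q - X5 K q * X2 K q)) -
      (q ^ 2 • (X4 K q * X3 K q) - q • (X2 K q * X5 K q - X5 K q * X2 K q)) :=
        congrArg₂ (· - ·) h1 h2
    rw [add_smul, one_smul]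
    nth_rewrite 1 [h3]
    module
  exact sub_eq_zero.mp ((smul_eq_zero.mp h).resolve_left hq2)

theorem X5_mul_X2 (hq : q ≠ 0) (hq2 : 1 + q ^ 2 ≠ 0) :
    X5 K q * X2 K q = X2 K q * X5 K q - (q - q⁻¹) • (X3 K q * X4 K q) := by
  have h1 := X4_mul_X3_eq_sub_commutator (K := K) hq
  rw [X4_mul_X3 hq hq2] at h1
  have h2 := congrArg (q⁻¹ • ·) h1
  simp only [smul_sub, smul_smul, inv_mul_cancel₀ hq, one_smul] at h2
  rw [show q⁻¹ * q ^ 2 = q by field_simp] at h2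
  rw [sub_smul, h2]
  abel

theorem X3_mul_X2 (hq : q ≠ 0) (hq2 : 1 + q ^ 2 ≠ 0) :
    X3 K q * X2 K q = q⁻¹ • (X2 K q * X3 K q) := by
  have h : X3 K q * X1 K q = q⁻¹ • (X1 K q * X3 K q) := by
    rw [X1_mul_X3 hq, smul_smul, inv_mul_cancel₀ hq, one_smul]
  have := mul_qcomm (r := q⁻¹) h (by rw [X4_mul_X3 hq hq2, one_smul] :
    X3 K q * X4 K q = (1 : K) • (X4 K q * X3 K q))
  rwa [mul_one] at this

theorem X3_mul_X5 (hq : q ≠ 0) (hq2 : 1 + q ^ 2 ≠ 0) :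
    X3 K q * X5 K q = q • (X5 K q * X3 K q) := by
  have h : X3 K q * X6 K q = q • (X6 K q * X3 K q) := by
    rw [X6_mul_X3 hq, smul_smul, mul_inv_cancel₀ hq, one_smul]
  have := mul_qcomm (r := q⁻¹) (by rw [X4_mul_X3 hq hq2, one_smul] :
    X3 K q * X4 K q = (1 : K) • (X4 K q * X3 K q)) h
  rwa [one_mul] at this

end Straightening

section PBW

variable {K : Type*} [Field K] {A : Type*} [Ring A] [Algebra K A]

/-- One step of an iterated Ore extension: if `x s ⊆ B x + B` for a generating set `s` of `B` and
`P` spans `B`, then the elements `p x ^ n` with `p ∈ P` span the algebra generated by `B`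
and `x`. -/
theorem adjoin_insert_le_span {s P : Set A} {x : A}
    (hP : (Algebra.adjoin K s : Set A) ⊆ Submodule.span K P)
    (hx : ∀ a ∈ s, ∃ b ∈ Algebra.adjoin K s, ∃ c ∈ Algebra.adjoin K s, x * a = b * x + c) :
    (Algebra.adjoin K (insert x s) : Set A) ⊆
      Submodule.span K {f | ∃ p ∈ P, ∃ n : ℕ, f = p * x ^ n} := by
  set B := Algebra.adjoin K s
  have hx' : ∀ a ∈ B, ∃ b ∈ B, ∃ c ∈ B, x * a = b * x + c := by
    intro a ha
    induction ha using Algebra.adjoin_induction with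
    | mem a ha => exact hx a ha
    | algebraMap r =>
      exact ⟨_, algebraMap_mem B r, 0, zero_mem _, by rw [add_zero, Algebra.commutes]⟩
    | add a a' _ _ h h' =>
      obtain ⟨b, hb, c, hc, h⟩ := h
      obtain ⟨b', hb', c', hc', h'⟩ := h'
      exact ⟨_, add_mem hb hb', _, add_mem hc hc', by rw [mul_add, h, h', add_mul]; abel⟩
    | mul a a' _ ha' h h' =>
      obtain ⟨b, hb, c, hc, h⟩ := h
      obtain ⟨b', hb', c', hc', h'⟩ := h'
      exact ⟨_, mul_mem hb hb', _, add_mem (mul_mem hb hc') (mul_mem hc ha'), by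
        rw [← mul_assoc, h, add_mul, mul_assoc, h', mul_add]; simp only [mul_assoc]; abel⟩
  set W := Submodule.span K {f | ∃ p ∈ P, ∃ n : ℕ, f = p * x ^ n}
  have hBW : ∀ b ∈ B, ∀ n : ℕ, b * x ^ n ∈ W := by
    intro b hb n
    have := Submodule.mem_map_of_mem (f := LinearMap.mulRight K (x ^ n)) (hP hb)
    rw [Submodule.map_span] at this
    refine Submodule.span_mono ?_ this
    rintro _ ⟨p, hp, rfl⟩
    exact ⟨p, hp, n, rfl⟩
  set W' := Submodule.span K {f | ∃ b ∈ B, ∃ n : ℕ, f = b * x ^ n}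
  have hmem : ∀ b ∈ B, ∀ n : ℕ, b * x ^ n ∈ W' := fun b hb n =>
    Submodule.subset_span ⟨b, hb, n, rfl⟩
  have hstep : ∀ g, (∀ b ∈ B, ∀ n : ℕ, g * (b * x ^ n) ∈ W') → ∀ f ∈ W', g * f ∈ W' := by
    intro g hg f hf
    induction hf using Submodule.span_induction with
    | mem f hf => obtain ⟨b, hb, n, rfl⟩ := hf; exact hg b hb n
    | zero => rw [mul_zero]; exact zero_mem _
    | add f₁ f₂ _ _ h₁ h₂ => rw [mul_add]; exact add_mem h₁ h₂
    | smul c f _ h => rw [mul_smul_comm]; exact Submodule.smul_mem _ _ h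
  have hstable : ∀ u ∈ Algebra.adjoin K (insert x s), ∀ f ∈ W', u * f ∈ W' := by
    intro u hu
    induction hu using Algebra.adjoin_induction with
    | mem u hu =>
      refine hstep u fun b hb n => ?_
      rcases hu with rfl | hu
      · obtain ⟨b₁, h₁, b₂, h₂, h⟩ := hx' b hb
        rw [← mul_assoc, h, add_mul, mul_assoc, ← pow_succ']
        exact add_mem (hmem _ h₁ _) (hmem _ h₂ _)
      · rw [← mul_assoc]
        exact hmem _ (mul_mem (Algebra.subset_adjoin hu) hb) _
    | algebraMap r =>
      intro f hf
      rw [← Algebra.smul_def]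
      exact Submodule.smul_mem _ _ hf
    | add u v _ _ h₁ h₂ => intro f hf; rw [add_mul]; exact add_mem (h₁ f hf) (h₂ f hf)
    | mul u v _ _ h₁ h₂ => intro f hf; rw [mul_assoc]; exact h₁ _ (h₂ f hf)
  intro u hu
  have h1 : u ∈ W' := by
    have := hstable u hu (1 * x ^ 0) (hmem 1 (one_mem _) 0)
    rwa [one_mul, pow_zero, mul_one] at this
  refine Submodule.span_le.mpr ?_ h1
  rintro _ ⟨b, hb, n, rfl⟩
  exact hBW b hb n

end PBW

section PBW

variable {K : Type*} [Field K]

variable (K) in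
/-- The PBW monomial `X_1 ^ a_1 ⋯ X_6 ^ a_6`. -/
def pbw (q : K) (a : Fin 6 → ℕ) : Uq K q :=
  X1 K q ^ a 0 * X2 K q ^ a 1 * X3 K q ^ a 2 * X4 K q ^ a 3 * X5 K q ^ a 4 * X6 K q ^ a 5

theorem adjoin_eq_top_of_e_mem {q : K} {S : Subalgebra K (Uq K q)} (h : ∀ i, e K q i ∈ S) :
    S = ⊤ := by
  -- the homomorphism into `S` given on the generators, followed by the inclusion, is the identity
  let f : Uq K q →ₐ[K] S := RingQuot.liftAlgHom K
    ⟨FreeAlgebra.lift K fun i => (⟨e K q i, h i⟩ : S), fun x y hxy => by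
      have hval : ∀ z, ((FreeAlgebra.lift K fun i => (⟨e K q i, h i⟩ : S)) z : Uq K q)
          = mk K q z := by
        intro z
        exact DFunLike.congr_fun (FreeAlgebra.hom_ext (f := S.val.comp (FreeAlgebra.lift K
          fun i => (⟨e K q i, h i⟩ : S))) (g := mk K q)
          (by ext i; simp [e])) z
      exact Subtype.ext (by rw [hval, hval]; exact mk_rel K q hxy)⟩
  have hf : S.val.comp f = AlgHom.id K _ := algHom_ext K q fun i => by
    have : f (e K q i) = FreeAlgebra.lift K (fun i => (⟨e K q i, h i⟩ : S))
        (FreeAlgebra.ι K i) := RingQuot.liftAlgHom_mkAlgHom_apply K _ _ _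
    simp [this]
  rw [eq_top_iff]
  intro u _
  have := DFunLike.congr_fun hf u
  rw [AlgHom.comp_apply, AlgHom.id_apply] at this
  rw [← this]
  exact (f u).2

theorem span_pbw {q : K} (hq : q ≠ 0) (hq2 : 1 + q ^ 2 ≠ 0) :
    Submodule.span K (Set.range (pbw K q)) = ⊤ := by
  have mem {s : Set (Uq K q)} {a : Uq K q} (h : a ∈ s) : a ∈ Algebra.adjoin K s :=
    Algebra.subset_adjoin h
  have h0 : (Algebra.adjoin K (∅ : Set (Uq K q)) : Set (Uq K q)) ⊆
      Submodule.span K {(1 : Uq K q)} := by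
    rw [Algebra.adjoin_empty]
    rintro _ ⟨r, rfl⟩
    exact Submodule.mem_span_singleton.mpr ⟨r, (Algebra.algebraMap_eq_smul_one r).symm⟩
  have h1 := adjoin_insert_le_span (x := X1 K q) h0 (by simp)
  have h2 := adjoin_insert_le_span (x := X2 K q) h1 (by
    rintro a (rfl | h)
    · exact ⟨q⁻¹ • X1 K q, Subalgebra.smul_mem _ (mem (by simp)) _, 0, zero_mem _, by
        rw [smul_mul_assoc, X1_mul_X2 hq, smul_smul, inv_mul_cancel₀ hq, one_smul, add_zero]⟩
    · simp at h)
  have h3 := adjoin_insert_le_span (x := X3 K q) h2 (by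
    rintro a (rfl | rfl | h)
    · exact ⟨q⁻¹ • X2 K q, Subalgebra.smul_mem _ (mem (by simp)) _, 0, zero_mem _, by
        rw [smul_mul_assoc, X3_mul_X2 hq hq2, add_zero]⟩
    · exact ⟨q⁻¹ • X1 K q, Subalgebra.smul_mem _ (mem (by simp)) _, 0, zero_mem _, by
        rw [smul_mul_assoc, X1_mul_X3 hq, smul_smul, inv_mul_cancel₀ hq, one_smul, add_zero]⟩
    · simp at h)
  have h4 := adjoin_insert_le_span (x := X4 K q) h3 (by
    rintro a (rfl | rfl | rfl | h)
    · exact ⟨X3 K q, mem (by simp), 0, zero_mem _, by rw [X4_mul_X3 hq hq2, add_zero]⟩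
    · exact ⟨q⁻¹ • X2 K q, Subalgebra.smul_mem _ (mem (by simp)) _, 0, zero_mem _, by
        rw [smul_mul_assoc, X2_mul_X4 hq, smul_smul, inv_mul_cancel₀ hq, one_smul, add_zero]⟩
    · exact ⟨q • X1 K q, Subalgebra.smul_mem _ (mem (by simp)) _, -(q • X2 K q),
        neg_mem (Subalgebra.smul_mem _ (mem (by simp)) _), by
        rw [X4_mul_X1 hq, smul_mul_assoc, sub_eq_add_neg]⟩
    · simp at h)
  have h5 := adjoin_insert_le_span (x := X5 K q) h4 (by
    rintro a (rfl | rfl | rfl | rfl | h)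
    · exact ⟨q⁻¹ • X4 K q, Subalgebra.smul_mem _ (mem (by simp)) _, 0, zero_mem _, by
        rw [smul_mul_assoc, X4_mul_X5 hq, smul_smul, inv_mul_cancel₀ hq, one_smul, add_zero]⟩
    · exact ⟨q⁻¹ • X3 K q, Subalgebra.smul_mem _ (mem (by simp)) _, 0, zero_mem _, by
        rw [smul_mul_assoc, X3_mul_X5 hq hq2, smul_smul, inv_mul_cancel₀ hq, one_smul, add_zero]⟩
    · exact ⟨X2 K q, mem (by simp), -((q - q⁻¹) • (X3 K q * X4 K q)),
        neg_mem (Subalgebra.smul_mem _ (mul_mem (mem (by simp)) (mem (by simp))) _), by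
        rw [X5_mul_X2 hq hq2, sub_eq_add_neg]⟩
    · exact ⟨q • X1 K q, Subalgebra.smul_mem _ (mem (by simp)) _, -(q • X3 K q),
        neg_mem (Subalgebra.smul_mem _ (mem (by simp)) _), by
        rw [X5_mul_X1 hq, smul_mul_assoc, sub_eq_add_neg]⟩
    · simp at h)
  have h6 := adjoin_insert_le_span (x := X6 K q) h5 (by
    rintro a (rfl | rfl | rfl | rfl | rfl | h)
    · exact ⟨q⁻¹ • X5 K q, Subalgebra.smul_mem _ (mem (by simp)) _, 0, zero_mem _, by
        rw [smul_mul_assoc, X5_mul_X6 hq, smul_smul, inv_mul_cancel₀ hq, one_smul, add_zero]⟩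
    · exact ⟨q • X4 K q, Subalgebra.smul_mem _ (mem (by simp)) _, -(q • X5 K q),
        neg_mem (Subalgebra.smul_mem _ (mem (by simp)) _), by
        rw [X6_mul_X4 hq, smul_mul_assoc, sub_eq_add_neg]⟩
    · exact ⟨q⁻¹ • X3 K q, Subalgebra.smul_mem _ (mem (by simp)) _, 0, zero_mem _, by
        rw [smul_mul_assoc, X6_mul_X3 hq, add_zero]⟩
    · exact ⟨q • X2 K q, Subalgebra.smul_mem _ (mem (by simp)) _, -(q • X3 K q),
        neg_mem (Subalgebra.smul_mem _ (mem (by simp)) _), by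
        rw [X6_mul_X2 hq, smul_mul_assoc, sub_eq_add_neg]⟩
    · exact ⟨X1 K q, mem (by simp), 0, zero_mem _, by rw [X6_mul_X1, add_zero]⟩
    · simp at h)
  rw [adjoin_eq_top_of_e_mem (S := Algebra.adjoin K (insert (X6 K q) (insert (X5 K q)
    (insert (X4 K q) (insert (X3 K q) (insert (X2 K q) (insert (X1 K q) ∅))))))) (fun i => by
    fin_cases i
    · exact mem (by simp [X1])
    · exact mem (by simp [X4])
    · exact mem (by simp [X6]))] at h6
  rw [eq_top_iff]
  intro u _
  refine Submodule.span_mono ?_ (h6 (Algebra.mem_top (x := u)))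
  rintro _ ⟨_, ⟨_, ⟨_, ⟨_, ⟨_, ⟨_, rfl, a, rfl⟩, b, rfl⟩, c, rfl⟩, d, rfl⟩, e, rfl⟩, f, rfl⟩
  exact ⟨![a, b, c, d, e, f], by simp [pbw]⟩

end PBW

/-! ### Leading terms and injectivity of the embedding -/

section LeadingTerms

variable {K : Type*} [Field K]

/-- Exponents are compared lexicographically, starting from the last coordinate. -/
def key : (Fin 6 → ℤ) →+ Lex (Fin 6 → ℤ) :=
  AddMonoidHom.mk' (fun v => toLex fun i => v i.rev) fun _ _ => rfl

theorem key_injective : Function.Injective key := by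
  intro v w h
  funext i
  have := congrFun (toLex.injective h) i.rev
  simpa using this

theorem key_lt_key_iff {v w : Fin 6 → ℤ} : key v < key w ↔
    ∃ i : Fin 6, (∀ j : Fin 6, j < i → v j.rev = w j.rev) ∧ v i.rev < w i.rev := Iff.rfl

theorem key_lt_key {v w : Fin 6 → ℤ} (i : Fin 6) (h : ∀ j, i < j → v j = w j) (hi : v i < w i) :
    key v < key w :=
  key_lt_key_iff.mpr ⟨i.rev, fun j hj => h _ (by rwa [← Fin.rev_lt_rev, Fin.rev_rev]), by
    rwa [Fin.rev_rev]⟩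

variable (K) in
/-- The six generators of the PBW basis. -/
def Xs (q : K) : Fin 6 → Uq K q := ![X1 K q, X2 K q, X3 K q, X4 K q, X5 K q, X6 K q]

variable {q : Kˣ}

theorem one_sub_ne_zero (hq : ∀ n : ℤ, n ≠ 0 → q ^ n ≠ 1) : 1 - (q : K)⁻¹ ^ 2 ≠ 0 := by
  intro h
  refine hq (-2) (by norm_num) (Units.ext ?_)
  rw [Units.val_zpow_eq_zpow_val, Units.val_one, zpow_neg, ← inv_zpow]
  exact_mod_cast (sub_eq_zero.mp h).symm

theorem sub_inv_ne_zero (hq : ∀ n : ℤ, n ≠ 0 → q ^ n ≠ 1) : (q : K) - (q : K)⁻¹ ≠ 0 := by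
  have h := mul_ne_zero q.ne_zero (one_sub_ne_zero hq)
  contrapose! h
  rw [← h]
  field_simp [q.ne_zero]

theorem one_add_sq_ne_zero (hq : ∀ n : ℤ, n ≠ 0 → q ^ n ≠ 1) : 1 + (q : K) ^ 2 ≠ 0 := by
  intro h
  refine hq 4 (by norm_num) (Units.ext ?_)
  rw [Units.val_zpow_eq_zpow_val, Units.val_one]
  norm_cast
  push_cast
  linear_combination ((q : K) ^ 2 - 1) * h

theorem isLead_Xs (hq : ∀ n : ℤ, n ≠ 0 → q ^ n ≠ 1) (i : Fin 6) :
    IsLead key (toTorus q (Xs K q i)) (Pi.single i 1) := by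
  have h1 := one_sub_ne_zero hq
  have hs : ∀ i : Fin 6, (Pi.single i 1 : Fin 6 → ℤ) = ![![1, 0, 0, 0, 0, 0], ![0, 1, 0, 0, 0, 0],
    ![0, 0, 1, 0, 0, 0], ![0, 0, 0, 1, 0, 0], ![0, 0, 0, 0, 1, 0], ![0, 0, 0, 0, 0, 1]] i := by
    decide
  rw [hs]
  fin_cases i
  · change IsLead key (toTorus q (X1 K q)) _
    rw [toTorus_X1]
    exact isLead_M _
  · change IsLead key (toTorus q (X2 K q)) _
    rw [toTorus_X2]
    exact (isLead_M _).smul h1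
  · change IsLead key (toTorus q (X3 K q)) _
    rw [toTorus_X3]
    exact (isLead_M _).smul (pow_ne_zero 2 h1)
  · change IsLead key (toTorus q (X4 K q)) _
    rw [toTorus_X4]
    exact (isLead_M _).add (suppLE_M _) (key_lt_key 3 (by decide) (by decide))
  · change IsLead key (toTorus q (X5 K q)) _
    rw [toTorus_X5]
    exact (((isLead_M _).add ((suppLE_M _).smul _) (key_lt_key 4 (by decide) (by decide))).add
      (suppLE_M _) (key_lt_key 4 (by decide) (by decide))).smul h1
  · change IsLead key (toTorus q (X6 K q)) _
    rw [toTorus_X6]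
    exact ((isLead_M _).add (suppLE_M _) (key_lt_key 5 (by decide) (by decide))).add (suppLE_M _)
      (key_lt_key 5 (by decide) (by decide))

theorem isLead_pbw (hq : ∀ n : ℤ, n ≠ 0 → q ^ n ≠ 1) (a : Fin 6 → ℕ) :
    IsLead key (toTorus q (pbw K q a)) (fun i => (a i : ℤ)) := by
  have h := fun i => (isLead_Xs hq i).pow key_injective (a i)
  have h' := ((((((h 0).mul key_injective (h 1)).mul key_injective (h 2)).mul key_injective
    (h 3)).mul key_injective (h 4)).mul key_injective (h 5))
  simp only [← map_pow, ← map_mul] at h'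
  have hv : (fun i => (a i : ℤ)) = a 0 • Pi.single 0 1 + a 1 • Pi.single 1 1 +
      a 2 • Pi.single 2 1 + a 3 • Pi.single 3 1 + a 4 • Pi.single 4 1 + a 5 • Pi.single 5 1 := by
    funext i
    fin_cases i <;> simp
  rw [hv]
  exact h'

/-- The leading exponent of the image of a nonzero element is a vector of natural numbers. -/
theorem exists_isLead (hq : ∀ n : ℤ, n ≠ 0 → q ^ n ≠ 1) {u : Uq K (q : K)} (hu : u ≠ 0) :
    ∃ a : Fin 6 → ℕ, IsLead key (toTorus q u) (fun i => (a i : ℤ)) := by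
  have hmem : u ∈ Submodule.span K (Set.range (pbw K (q : K))) := by
    rw [span_pbw q.ne_zero (one_add_sq_ne_zero hq)]; trivial
  obtain ⟨c, rfl⟩ := (Finsupp.mem_span_range_iff_exists_finsupp).mp hmem
  have hc : ∃ a ∈ c.support, c a ≠ 0 := by
    by_contra! h
    exact hu (Finset.sum_eq_zero fun a ha => (congrArg (· • _) (h a ha)).trans (zero_smul K _))
  obtain ⟨a, -, -, ha⟩ := exists_isLead_sum key_injective c
    (v := fun (a : Fin 6 → ℕ) i => (a i : ℤ)) (fun a b h => by
      funext i; exact Int.ofNat.inj (congrFun h i)) (isLead_pbw hq) hc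
  refine ⟨a, ?_⟩
  rw [Finsupp.sum, map_sum]
  simpa only [map_smul] using ha

theorem toTorus_injective (hq : ∀ n : ℤ, n ≠ 0 → q ^ n ≠ 1) :
    Function.Injective (toTorus (K := K) q) := by
  rw [injective_iff_map_eq_zero]
  intro u h
  by_contra hu
  obtain ⟨a, ha⟩ := exists_isLead hq hu
  apply ha.2
  rw [h, map_zero]

/-- The exponent `v` has a negative coordinate. -/
def HasNeg (v : Fin 6 → ℤ) : Prop := ∃ i, v i < 0

/-- The images of the PBW monomials and the monomials with a negative exponent together span the
quantum torus, by triangularity. -/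
theorem exists_sub_hasNeg (hq : ∀ n : ℤ, n ≠ 0 → q ^ n ≠ 1) (f : QTorus q (Om)) :
    ∃ u : Uq K (q : K), ∀ v, coeff v (f - toTorus q u) ≠ 0 → HasNeg v := by
  set S : Submodule K (QTorus q Om) :=
    { carrier := {f | ∃ u : Uq K (q : K), ∀ v, coeff v (f - toTorus q u) ≠ 0 → HasNeg v}
      zero_mem' := ⟨0, fun v hv => by simp at hv⟩
      add_mem' := by
        rintro f g ⟨u, hu⟩ ⟨u', hu'⟩
        refine ⟨u + u', fun v hv => ?_⟩
        by_contra h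
        apply hv
        rw [map_add, add_sub_add_comm, map_add, not_not.mp (mt (hu v) h),
          not_not.mp (mt (hu' v) h), add_zero]
      smul_mem' := by
        rintro c f ⟨u, hu⟩
        refine ⟨c • u, fun v hv => ?_⟩
        by_contra h
        apply hv
        rw [map_smul, ← smul_sub, map_smul, not_not.mp (mt (hu v) h), smul_zero] }
  have hneg : ∀ v, HasNeg v → M q Om v ∈ S := fun v hv => ⟨0, fun w hw => by
    rw [map_zero, sub_zero, coeff_M] at hw
    by_cases h : v = w
    · exact h ▸ hv
    · simp [h] at hw⟩
  -- by well-founded induction, as the PBW monomials have all natural leading exponents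
  have hpos : ∀ a : Lex (Fin 6 → ℕ), M q Om (fun i => (ofLex a i.rev : ℤ)) ∈ S := by
    intro a
    induction a using WellFoundedLT.induction with
    | ind a ih =>
      obtain ⟨hle, hne⟩ := isLead_pbw (K := K) hq (fun i => ofLex a i.rev)
      set F := toTorus q (pbw K (q : K) fun i => ofLex a i.rev)
      set v : Fin 6 → ℤ := fun i => (ofLex a i.rev : ℤ)
      have hF : F ∈ S := ⟨pbw K (q : K) fun i => ofLex a i.rev, fun w hw => by simp [F] at hw⟩
      have hrest : ∑ w ∈ (supp F).erase v, coeff w F • M q Om w ∈ S := by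
        refine sum_mem fun w hw => Submodule.smul_mem _ _ ?_
        obtain ⟨hwv, hw⟩ := Finset.mem_erase.mp hw
        by_cases hn : HasNeg w
        · exact hneg w hn
        · have hn' : ∀ i, 0 ≤ w i := fun i => not_lt.mp fun h => hn ⟨i, h⟩
          have hlt : key w < key v :=
            lt_of_le_of_ne (hle w (mem_supp.mp hw)) fun h => hwv (key_injective h)
          have := ih (toLex fun i => (w i.rev).toNat) (by
            obtain ⟨i, hi, hi'⟩ := key_lt_key_iff.mp hlt
            refine ⟨i, fun j hj => ?_, ?_⟩
            · have h := hi j hj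
              simp only [v, Fin.rev_rev] at h
              change (w j.rev).toNat = ofLex a j
              omega
            · have := hn' i.rev
              simp only [v, Fin.rev_rev] at hi'
              change (w i.rev).toNat < ofLex a i
              omega)
          convert this using 2
          funext i
          simp [Int.toNat_of_nonneg (hn' i)]
      have hsum := eq_sum F
      rw [← Finset.add_sum_erase _ _ (mem_supp.mpr hne)] at hsum
      have : coeff v F • M q Om v ∈ S := by
        rw [eq_sub_of_add_eq hsum.symm]
        exact sub_mem hF hrest
      have h3 := S.smul_mem (coeff v F)⁻¹ this
      rwa [smul_smul, inv_mul_cancel₀ hne, one_smul] at h3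
  have : f ∈ S := by
    rw [eq_sum f]
    refine sum_mem fun v _ => S.smul_mem _ ?_
    by_cases hn : HasNeg v
    · exact hneg v hn
    · have hn' : ∀ i, 0 ≤ v i := fun i => not_lt.mp fun h => hn ⟨i, h⟩
      convert hpos (toLex fun i => (v i.rev).toNat) using 2
      funext i
      simp [Int.toNat_of_nonneg (hn' i)]
  exact this

end LeadingTerms

/-! ### Derivations with values in the quantum torus -/

section StructureOfDerivations

variable {K : Type*} [Field K] {q : Kˣ}

/-- A derivation along `toTorus` is determined by its values on the Chevalley generators. -/
theorem eq_zero_of_e {F : Uq K (q : K) →ₗ[K] QTorus q Om}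
    (hF : ∀ a b, F (a * b) = F a * toTorus q b + toTorus q a * F b)
    (h : ∀ i, F (e K (q : K) i) = 0) (u : Uq K (q : K)) : F u = 0 := by
  have h1 : F 1 = 0 := by
    have := hF 1 1
    rw [mul_one, map_one (toTorus q), mul_one, one_mul, left_eq_add] at this
    exact this
  let S : Subalgebra K (Uq K (q : K)) :=
    { carrier := {u | F u = 0}
      mul_mem' := fun {a b} (ha : F a = 0) (hb : F b = 0) => by
        change F (a * b) = 0
        rw [hF, ha, hb, zero_mul, mul_zero, add_zero]
      add_mem' := fun {a b} (ha : F a = 0) (hb : F b = 0) => by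
        change F (a + b) = 0
        rw [map_add, ha, hb, add_zero]
      algebraMap_mem' := fun r => by
        change F (algebraMap K _ r) = 0
        rw [Algebra.algebraMap_eq_smul_one, map_smul, h1, smul_zero] }
  have hS : S = ⊤ := adjoin_eq_top_of_e_mem h
  have : u ∈ S := hS ▸ Algebra.mem_top
  exact this

variable (K) in
/-- A cluster: six elements of `U_q(sl_4^+)` whose images in the quantum torus are monomials. -/
def cluster (q : K) : Fin 6 → Uq K q :=
  ![X1 K q, X2 K q, X3 K q, X2op K q, Δ2 K q, Δ3 K q]

/-- The exponents of the monomials in `cluster`. -/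
def clusterExp : Fin 6 → Fin 6 → ℤ :=
  ![![1, 0, 0, 0, 0, 0], ![0, 1, 0, 0, 0, 0], ![0, 0, 1, 0, 0, 0], ![1, 0, 0, 1, 0, 0],
    ![0, 1, 0, 0, 1, 0], ![1, 0, 0, 1, 0, 1]]

/-- The coefficients of the monomials in `cluster`. -/
noncomputable def clusterCoeff (q : K) : Fin 6 → K :=
  ![1, 1 - q⁻¹ ^ 2, (1 - q⁻¹ ^ 2) ^ 2, q - q⁻¹, (1 - q⁻¹ ^ 2) ^ 2, (q - q⁻¹) ^ 2]

theorem toTorus_cluster (i : Fin 6) :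
    toTorus q (cluster K (q : K) i) = clusterCoeff (q : K) i • M q Om (clusterExp i) := by
  fin_cases i
  · exact (toTorus_X1 q).trans (one_smul K _).symm
  · exact toTorus_X2 q
  · exact toTorus_X3 q
  · exact toTorus_X2op q
  · exact toTorus_Δ2 q
  · exact toTorus_Δ3 q

theorem clusterCoeff_ne_zero (hq : ∀ n : ℤ, n ≠ 0 → q ^ n ≠ 1) (i : Fin 6) :
    clusterCoeff (q : K) i ≠ 0 := by
  have h1 := one_sub_ne_zero hq
  have h2 := sub_inv_ne_zero hq
  fin_cases i
  · exact one_ne_zero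
  · exact h1
  · exact pow_ne_zero 2 h1
  · exact h2
  · exact pow_ne_zero 2 h1
  · exact pow_ne_zero 2 h2

/-- A derivation into the quantum torus vanishes if it does on the cluster, since the cluster
generates the skew field of fractions. -/
theorem eq_zero_of_cluster (hq : ∀ n : ℤ, n ≠ 0 → q ^ n ≠ 1)
    {F : Uq K (q : K) →ₗ[K] QTorus q Om}
    (hF : ∀ a b, F (a * b) = F a * toTorus q b + toTorus q a * F b)
    (h : ∀ i, F (cluster K (q : K) i) = 0) (u : Uq K (q : K)) : F u = 0 := by
  have hq0 : (q : K) ≠ 0 := q.ne_zero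
  have hcancel : ∀ i a, toTorus q (cluster K (q : K) i) * a = 0 → a = 0 := by
    intro i a ha
    rw [toTorus_cluster, smul_mul_assoc] at ha
    exact (isUnit_M _).mul_right_eq_zero.mp
      ((smul_eq_zero.mp ha).resolve_left (clusterCoeff_ne_zero hq i))
  have h1 : F (X1 K (q : K)) = 0 := h 0
  have h2 : F (X2 K (q : K)) = 0 := h 1
  have h3 : F (X3 K (q : K)) = 0 := h 2
  have h2' : F (X2op K (q : K)) = 0 := h 3
  have h4 : F (X4 K (q : K)) = 0 := by
    refine hcancel 0 _ ?_
    change toTorus q (X1 K (q : K)) * F (X4 K (q : K)) = 0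
    have e1 : (1 - (q : K)⁻¹ ^ 2) • (X1 K (q : K) * X4 K q) = X2 K q + (q : K)⁻¹ • X2op K q := by
      simp only [X1, X2, X4, X2op]
      module
    have e2 := congrArg F e1
    rw [map_smul, hF, h1, zero_mul, zero_add, map_add, map_smul, h2, h2', smul_zero,
      add_zero] at e2
    exact (smul_eq_zero.mp e2).resolve_left (one_sub_ne_zero hq)
  have h5 : F (X5 K (q : K)) = 0 := by
    refine hcancel 1 _ ?_
    change toTorus q (X2 K (q : K)) * F (X5 K (q : K)) = 0
    have e2 : F (Δ2 K (q : K)) = 0 := h 4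
    rw [Δ2, map_sub, map_smul, hF, hF, h2, h3, h4] at e2
    simpa using e2
  have h6 : F (X6 K (q : K)) = 0 := by
    refine hcancel 3 _ ?_
    change toTorus q (X2op K (q : K)) * F (X6 K (q : K)) = 0
    have e1 : ((q : K) - (q : K)⁻¹) • (X2op K (q : K) * X6 K q) = Δ3 K q
        + ((q : K) * (q - (q : K)⁻¹)) • (X1 K (q : K) * X5 K q) - (q : K) ^ 2 • X3 K q := by
      have e0 : X2op K (q : K) = ((q : K) - (q : K)⁻¹) • (X1 K (q : K) * X4 K q) -
          (q : K) • X2 K q := by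
        simp only [X1, X2, X4, X2op]
        match_scalars <;> field_simp
        ring
      rw [e0, Δ3]
      simp only [sub_mul, smul_mul_assoc]
      module
    have e2 := congrArg F e1
    have e3 : F (Δ3 K (q : K)) = 0 := h 5
    rw [map_smul, hF, map_sub, map_add, map_smul, map_smul, hF, h1, h2', h3, h5, e3] at e2
    simp only [zero_mul, mul_zero, zero_add, smul_zero, sub_zero] at e2
    exact (smul_eq_zero.mp e2).resolve_left (sub_inv_ne_zero hq)
  refine eq_zero_of_e hF (fun i => ?_) u
  fin_cases i
  · exact h1
  · exact h4
  · exact h6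

theorem β_Om (v w : Fin 6 → ℤ) : β Om v w =
    w 0 * (-v 1 - v 2 + v 3 + v 4) + w 1 * (v 0 - v 2 - v 3 + v 5)
      + w 2 * (v 0 + v 1 - v 4 - v 5) + w 3 * (-v 0 + v 1 - v 4 + v 5)
      + w 4 * (-v 0 + v 2 + v 3 - v 5) + w 5 * (-v 1 + v 2 - v 3 + v 4) := by
  rw [β, Om_apply, Om_apply]
  ring

theorem isCentral_iff {v : Fin 6 → ℤ} :
    IsCentral Om v ↔ v 0 = v 2 ∧ v 0 = v 3 ∧ v 0 = v 5 ∧ v 1 = v 4 := by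
  constructor
  · intro h
    have h0 := h ![1, 0, 0, 0, 0, 0]
    have h1 := h ![0, 1, 0, 0, 0, 0]
    have h2 := h ![0, 0, 1, 0, 0, 0]
    have h3 := h ![0, 0, 0, 1, 0, 0]
    simp [β_Om] at h0 h1 h2 h3
    omega
  · rintro ⟨h1, h2, h3, h4⟩ w
    rw [β_Om, ← h1, ← h2, ← h3, ← h4]
    ring

theorem isCentral_of_clusterExp {v : Fin 6 → ℤ} (h : ∀ i, β Om (clusterExp i) v = 0) :
    IsCentral Om v := by
  have h0 := h 0
  have h1 := h 1
  have h2 := h 2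
  have h3 := h 3
  have h5 := h 5
  simp [β_Om, clusterExp] at h0 h1 h2 h3 h5
  rw [isCentral_iff]
  omega

/-- The additive map `v ↦ ∑ v_i Z_i`. -/
noncomputable def zetaOf (Z : Fin 6 → QTorus q Om) : (Fin 6 → ℤ) →+ QTorus q Om :=
  AddMonoidHom.mk' (fun v => v 0 • Z 0 + v 1 • Z 1 + v 2 • Z 2 + v 3 • Z 3 + v 4 • Z 4 + v 5 • Z 5)
    (fun v w => by simp only [Pi.add_apply, add_smul]; abel)

theorem zetaOf_apply (Z : Fin 6 → QTorus q Om) (v : Fin 6 → ℤ) : zetaOf Z v =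
    v 0 • Z 0 + v 1 • Z 1 + v 2 • Z 2 + v 3 • Z 3 + v 4 • Z 4 + v 5 • Z 5 := rfl

theorem centralSupp_zetaOf {Z : Fin 6 → QTorus q Om} (hZ : ∀ i, CentralSupp (Z i))
    (v : Fin 6 → ℤ) : CentralSupp (zetaOf Z v) := by
  have hz : ∀ i (n : ℤ), CentralSupp (n • Z i) := fun i n => by
    rw [← Int.cast_smul_eq_zsmul K]
    exact (hZ i).smul _
  exact (((((hz _ _).add (hz _ _)).add (hz _ _)).add (hz _ _)).add (hz _ _)).add (hz _ _)

/-- Every derivation of `U_q(sl_4^+)` into the quantum torus is the restriction of a derivation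
`[x, -] + diag ζ` of the quantum torus. -/
theorem exists_eq_torusDer (hq : ∀ n : ℤ, n ≠ 0 → q ^ n ≠ 1)
    {D : Uq K (q : K) →ₗ[K] QTorus q Om}
    (hD : ∀ a b, D (a * b) = D a * toTorus q b + toTorus q a * D b) :
    ∃ (x : QTorus q Om) (Z : Fin 6 → QTorus q Om), (∀ i, CentralSupp (Z i)) ∧
      ∀ u, D u = torusDer x (zetaOf Z) (toTorus q u) := by
  obtain ⟨x, E, hE, h⟩ := exists_inner_add_central hq (toTorus_injective hq) hD
    (cluster K (q : K)) _ (clusterCoeff_ne_zero hq) clusterExp toTorus_cluster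
    (fun v => isCentral_of_clusterExp)
  -- the matrix expressing the unit vectors in terms of `clusterExp`
  let Z : Fin 6 → QTorus q Om := ![E 0, E 1, E 2, E 3 - E 0, E 4 - E 1, E 5 - E 3]
  have hZ : ∀ i, CentralSupp (Z i) := by
    intro i
    fin_cases i
    · exact hE 0
    · exact hE 1
    · exact hE 2
    · exact (hE 3).sub (hE 0)
    · exact (hE 4).sub (hE 1)
    · exact (hE 5).sub (hE 3)
  have hZE : ∀ i, zetaOf Z (clusterExp i) = E i := by
    intro i
    rw [zetaOf_apply]
    fin_cases i <;> simp [Z, clusterExp]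
  have hd := fun a b => torusDer_mul x (centralSupp_zetaOf hZ) (toTorus q a) (toTorus q b)
  refine ⟨x, Z, hZ, fun u => sub_eq_zero.mp ?_⟩
  refine eq_zero_of_cluster hq (F := D - (torusDer x (zetaOf Z)) ∘ₗ (toTorus q).toLinearMap)
    (fun a b => ?_) (fun i => ?_) u
  · simp only [LinearMap.sub_apply, LinearMap.comp_apply, AlgHom.toLinearMap_apply, hD, map_mul, hd]
    noncomm_ring
  · rw [LinearMap.sub_apply, h, LinearMap.comp_apply, AlgHom.toLinearMap_apply, torusDer_apply,
      toTorus_cluster, map_smul, diag_M, hZE]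
    simp only [mul_smul_comm, smul_mul_assoc, sub_self]

/-! ### The exchange relations of the cluster -/

/-- If `mutSpan deg Q` is stable under the images of the Chevalley generators, then it contains the
whole image of `U_q(sl_4^+)`. -/
theorem toTorus_mem_mutSpan {deg : (Fin 6 → ℤ) →+ ℤ} {Q : QTorus q Om}
    (h : ∀ i, ∀ f ∈ mutSpan deg Q, eT q i * f ∈ mutSpan deg Q) (u : Uq K (q : K)) :
    toTorus q u ∈ mutSpan deg Q := by
  let S : Subalgebra K (Uq K (q : K)) :=
    { carrier := {u | ∀ f ∈ mutSpan deg Q, toTorus q u * f ∈ mutSpan deg Q}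
      mul_mem' := fun {a b} ha hb f hf => by
        rw [map_mul, mul_assoc]
        exact ha _ (hb f hf)
      add_mem' := fun {a b} ha hb f hf => by
        rw [map_add, add_mul]
        exact add_mem (ha f hf) (hb f hf)
      algebraMap_mem' := fun r f hf => by
        rw [AlgHom.commutes, ← Algebra.smul_def]
        exact Submodule.smul_mem _ _ hf }
  have hS : S = ⊤ := adjoin_eq_top_of_e_mem fun i f hf => by
    rw [toTorus_e]
    exact h i f hf
  have hu : u ∈ S := hS ▸ Algebra.mem_top
  have := hu 1 (Submodule.subset_span ⟨0, 0, by simp, by rw [pow_zero, mul_one, one_def]⟩)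
  rwa [mul_one] at this

/-- The difference of two coordinates. -/
def coordSub (i j : Fin 6) : (Fin 6 → ℤ) →+ ℤ :=
  Pi.evalAddMonoidHom (fun _ => ℤ) i - Pi.evalAddMonoidHom (fun _ => ℤ) j

theorem coordSub_apply (i j : Fin 6) (v : Fin 6 → ℤ) : coordSub i j v = v i - v j := rfl

variable {x : QTorus q Om} {Z : Fin 6 → QTorus q Om}

/-- The constraint coming from the mutation of `X_1` to `X_4`. -/
theorem exchange_X1 (hZ : ∀ i, CentralSupp (Z i))
    (h : ∀ u, torusDer x (zetaOf Z) (toTorus q u) ∈ (toTorus (K := K) q).range) :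
    Z 1 = Z 0 + Z 3 := by
  set p : Fin 6 → ℤ := ![0, 0, 0, 1, 0, 0] with hp
  set p' : Fin 6 → ℤ := ![-1, 1, 0, 0, 0, 0] with hp'
  have d : coordSub 0 3 p = -1 := rfl
  have d' : coordSub 0 3 p' = -1 := rfl
  have hβ : ∀ v, β Om (p - p') v = 2 * coordSub 0 3 v := by
    intro v; simp [β_Om, coordSub_apply, hp, hp']; ring
  have hX : toTorus q (X4 K (q : K)) = (1 : K) • M q Om p + (1 : K) • M q Om p' := by
    rw [toTorus_X4, one_smul, one_smul]
  have hmem := fun u => toTorus_mem_mutSpan (deg := coordSub 0 3)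
    (Q := (1 : K) • M q Om p + (1 : K) • M q Om p') (fun i f hf => by
      fin_cases i
      · exact M_mul_mem_mutSpan (by decide) hf
      · have := Q_mul_mem_mutSpan d d' hβ 1 1 hf
        simpa [eT] using this
      · have h1 := M_mul_mem_mutSpan (w := ![0, 0, 0, 0, 0, 1]) (by decide) hf
        have h2 := M_mul_mem_mutSpan (w := ![0, 0, 0, -1, 1, 0]) (by decide) hf
        have h3 := M_mul_mem_mutSpan (w := ![0, -1, 1, 0, 0, 0]) (by decide) hf
        have := add_mem (add_mem h1 h2) h3
        rwa [← add_mul, ← add_mul] at this) u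
  obtain ⟨u, hu⟩ := h (X4 K (q : K))
  have key := eq_of_torusDer_mem_mutSpan d d' hβ 1 1 two_ne_zero one_ne_zero one_ne_zero x
    (centralSupp_zetaOf hZ) (by rw [← hX, ← hu]; exact hX ▸ hmem u)
  simp only [zetaOf_apply, hp, hp'] at key
  simp at key
  rw [key]; abel

/-- The constraint coming from the mutation of `X_2`. -/
theorem exchange_X2 (hq : ∀ n : ℤ, n ≠ 0 → q ^ n ≠ 1) (hZ : ∀ i, CentralSupp (Z i))
    (h : ∀ u, torusDer x (zetaOf Z) (toTorus q u) ∈ (toTorus (K := K) q).range) :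
    Z 1 + Z 4 = Z 2 + Z 3 := by
  set p : Fin 6 → ℤ := ![1, 0, 0, 0, 1, 0] with hp
  set p' : Fin 6 → ℤ := ![1, -1, 1, 1, 0, 0] with hp'
  have d : coordSub 1 4 p = -1 := rfl
  have d' : coordSub 1 4 p' = -1 := rfl
  have hβ : ∀ v, β Om (p - p') v = 2 * coordSub 1 4 v := by
    intro v; simp [β_Om, coordSub_apply, hp, hp']; ring
  have hX := toTorus_mutX2 q
  set a := ((q : K) - (q : K)⁻¹) * (1 - (q : K)⁻¹ ^ 2)
  have ha : a ≠ 0 := mul_ne_zero (sub_inv_ne_zero hq) (one_sub_ne_zero hq)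
  have hmem := fun u => toTorus_mem_mutSpan (deg := coordSub 1 4)
    (Q := a • M q Om p + (a * q) • M q Om p') (fun i f hf => by
      fin_cases i
      · exact M_mul_mem_mutSpan (by decide) hf
      · have h1 := M_mul_mem_mutSpan (w := ![0, 0, 0, 1, 0, 0]) (by decide) hf
        have h2 := M_mul_mem_mutSpan (w := ![-1, 1, 0, 0, 0, 0]) (by decide) hf
        have := add_mem h1 h2
        rwa [← add_mul] at this
      · have h1 := M_mul_mem_mutSpan (w := ![0, 0, 0, 0, 0, 1]) (by decide) hf
        have h2 := M_mul_mem_mutSpan (w := ![-1, 0, 0, -1, 0, 0]) (by decide)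
          (Q_mul_mem_mutSpan d d' hβ a (a * q) hf)
        have := add_mem h1 (Submodule.smul_mem _ (a⁻¹ * q) h2)
        rw [← mul_assoc, ← smul_mul_assoc, ← add_mul] at this
        convert this using 2
        have hq0 : (q : K) ≠ 0 := q.ne_zero
        simp only [eT, Fin.reduceFinMk, Matrix.cons_val, hp, hp', mul_add, mul_smul_comm,
          mon_mul_mon]
        norm_num
        match_scalars <;> field_simp) u
  obtain ⟨u, hu⟩ := h (mutX2 K (q : K))
  have key := eq_of_torusDer_mem_mutSpan d d' hβ a (a * q) two_ne_zero ha
    (mul_ne_zero ha q.ne_zero) x (centralSupp_zetaOf hZ) (by rw [← hX, ← hu]; exact hX ▸ hmem u)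
  simp only [zetaOf_apply, hp, hp'] at key
  simp at key
  have key' := congrArg (fun f => f - Z 0 + Z 1) key
  calc Z 1 + Z 4 = Z 0 + Z 4 - Z 0 + Z 1 := by abel
    _ = _ := key'
    _ = _ := by abel

/-- The constraint coming from the mutation of `X2op`. -/
theorem exchange_X2op (hq : ∀ n : ℤ, n ≠ 0 → q ^ n ≠ 1) (hZ : ∀ i, CentralSupp (Z i))
    (h : ∀ u, torusDer x (zetaOf Z) (toTorus q u) ∈ (toTorus (K := K) q).range) :
    Z 4 = Z 3 + Z 5 := by
  set p : Fin 6 → ℤ := ![0, 1, 0, 0, 0, 1] with hp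
  set p' : Fin 6 → ℤ := ![0, 1, 0, -1, 1, 0] with hp'
  have d : coordSub 3 5 p = -1 := rfl
  have d' : coordSub 3 5 p' = -1 := rfl
  have hβ : ∀ v, β Om (p - p') v = 2 * coordSub 3 5 v := by
    intro v; simp [β_Om, coordSub_apply, hp, hp']; ring
  have hX := toTorus_mutX2op q
  set a := ((q : K) - (q : K)⁻¹) * (1 - (q : K)⁻¹ ^ 2)
  have ha : a ≠ 0 := mul_ne_zero (sub_inv_ne_zero hq) (one_sub_ne_zero hq)
  have hmem := fun u => toTorus_mem_mutSpan (deg := coordSub 3 5)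
    (Q := a • M q Om p + a • M q Om p') (fun i f hf => by
      fin_cases i
      · exact M_mul_mem_mutSpan (by decide) hf
      · have h1 := M_mul_mem_mutSpan (w := ![0, 0, 0, 1, 0, 0]) (by decide) hf
        have h2 := M_mul_mem_mutSpan (w := ![-1, 1, 0, 0, 0, 0]) (by decide) hf
        have := add_mem h1 h2
        rwa [← add_mul] at this
      · have h1 := M_mul_mem_mutSpan (w := ![0, -1, 1, 0, 0, 0]) (by decide) hf
        have h2 := M_mul_mem_mutSpan (w := ![0, -1, 0, 0, 0, 0]) (by decide)
          (Q_mul_mem_mutSpan d d' hβ a a hf)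
        have := add_mem (Submodule.smul_mem _ a⁻¹ h2) h1
        rw [← mul_assoc, ← smul_mul_assoc, ← add_mul] at this
        convert this using 2
        have hq0 : (q : K) ≠ 0 := q.ne_zero
        simp only [eT, Fin.reduceFinMk, Matrix.cons_val, hp, hp', mul_add, mul_smul_comm,
          mon_mul_mon]
        norm_num
        match_scalars <;> field_simp) u
  obtain ⟨u, hu⟩ := h (mutX2op K (q : K))
  have key := eq_of_torusDer_mem_mutSpan d d' hβ a a two_ne_zero ha ha x
    (centralSupp_zetaOf hZ) (by rw [← hX, ← hu]; exact hX ▸ hmem u)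
  simp only [zetaOf_apply, hp, hp'] at key
  simp at key
  have key' := congrArg (fun f => f - Z 1 + Z 3) key
  calc Z 4 = Z 1 + (-Z 3 + Z 4) - Z 1 + Z 3 := by abel
    _ = Z 1 + Z 5 - Z 1 + Z 3 := by rw [key']; abel
    _ = _ := by abel

end StructureOfDerivations

/-! ### The center -/

section Center

variable {K : Type*} [Field K] {q : Kˣ}

theorem M_pow (v : Fin 6 → ℤ) (n : ℕ) : ∃ c : K, c ≠ 0 ∧ M q Om v ^ n = c • M q Om (n • v) := by
  induction n with
  | zero => exact ⟨1, one_ne_zero, by rw [pow_zero, zero_smul, one_smul, one_def]⟩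
  | succ n ih =>
    obtain ⟨c, hc, h⟩ := ih
    refine ⟨c * ((q ^ Om (n • v) v : Kˣ) : K), mul_ne_zero hc (Units.ne_zero _), ?_⟩
    rw [pow_succ, h, smul_mul_assoc, M_mul_M, smul_smul, succ_nsmul]

theorem centralSupp_M {v : Fin 6 → ℤ} (hv : IsCentral Om v) (c : K) :
    CentralSupp (c • M q Om v) := by
  intro w hw
  rw [map_smul, coeff_M] at hw
  by_cases h : v = w
  · exact h ▸ hv
  · simp [h] at hw

theorem mem_center_of_centralSupp (hq : ∀ n : ℤ, n ≠ 0 → q ^ n ≠ 1) {u : Uq K (q : K)}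
    (h : CentralSupp (toTorus q u)) : u ∈ Subalgebra.center K (Uq K (q : K)) := by
  rw [Subalgebra.mem_center_iff]
  intro a
  apply toTorus_injective hq
  rw [map_mul, map_mul, h.commute]

/-- A central element commutes with the cluster, hence with all monomials of the quantum torus. -/
theorem centralSupp_of_mem_center (hq : ∀ n : ℤ, n ≠ 0 → q ^ n ≠ 1) {u : Uq K (q : K)}
    (h : u ∈ Subalgebra.center K (Uq K (q : K))) : CentralSupp (toTorus q u) := by
  rw [Subalgebra.mem_center_iff] at h
  intro v hv
  refine isCentral_of_clusterExp fun i => ?_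
  have h1 := congrArg (toTorus q) (h (cluster K (q : K) i))
  rw [map_mul, map_mul, toTorus_cluster, smul_mul_assoc, mul_smul_comm] at h1
  have h2 := smul_right_injective _ (clusterCoeff_ne_zero hq i) h1
  rw [M_mul_eq_conj_mul] at h2
  have h3 := congrArg (coeff v) ((isUnit_M _).mul_right_cancel h2)
  rw [coeff_conj] at h3
  by_contra hβ
  refine hq _ hβ (Units.ext ?_)
  rw [Units.val_one]
  exact mul_right_cancel₀ hv (h3.trans (one_mul _).symm)

/-- The exponents of `z_1` and `z_2`. -/
def zExp : Fin 2 → Fin 6 → ℤ := ![![1, 0, 1, 1, 0, 1], ![0, 1, 0, 0, 1, 0]]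

theorem toTorus_z1_pow_mul_z2_pow (hq : ∀ n : ℤ, n ≠ 0 → q ^ n ≠ 1) (a b : ℕ) :
    ∃ c : K, c ≠ 0 ∧ toTorus q (z1 K (q : K) ^ a * z2 K (q : K) ^ b) =
      c • M q Om (a • zExp 0 + b • zExp 1) := by
  have h1 := one_sub_ne_zero hq
  have h2 := sub_inv_ne_zero hq
  obtain ⟨c, hc, hM⟩ := M_pow (K := K) (q := q) (zExp 0) a
  obtain ⟨c', hc', hM'⟩ := M_pow (K := K) (q := q) (zExp 1) b
  refine ⟨(((q : K) - (q : K)⁻¹) ^ 2 * (1 - (q : K)⁻¹ ^ 2) ^ 2 * (q : K)⁻¹) ^ a *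
    ((1 - (q : K)⁻¹ ^ 2) ^ 2) ^ b * (c * c' * ((q ^ Om (a • zExp 0) (b • zExp 1) : Kˣ) : K)),
    ?_, ?_⟩
  · have := q.ne_zero
    have := Units.ne_zero (q ^ Om (a • zExp 0) (b • zExp 1))
    positivity
  · rw [map_mul, map_pow, map_pow, toTorus_z1, z2, toTorus_Δ2, smul_pow, smul_pow]
    change _ • M q Om (zExp 0) ^ a * _ • M q Om (zExp 1) ^ b = _
    rw [hM, hM', smul_mul_smul_comm, smul_mul_smul_comm, M_mul_M, smul_smul, smul_smul,
      mul_assoc (_ * _) (c * c')]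

theorem isCentral_zExp (a b : ℕ) : IsCentral Om (a • zExp 0 + b • zExp 1) := by
  rw [isCentral_iff]
  simp [zExp]

theorem adjoin_le_center (hq : ∀ n : ℤ, n ≠ 0 → q ^ n ≠ 1) :
    Algebra.adjoin K {z1 K (q : K), z2 K (q : K)} ≤ Subalgebra.center K (Uq K (q : K)) := by
  have h : ∀ a b : ℕ, z1 K (q : K) ^ a * z2 K (q : K) ^ b ∈
      Subalgebra.center K (Uq K (q : K)) := fun a b => mem_center_of_centralSupp hq (by
    obtain ⟨c, -, h⟩ := toTorus_z1_pow_mul_z2_pow hq a b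
    rw [h]
    exact centralSupp_M (isCentral_zExp a b) c)
  refine Algebra.adjoin_le ?_
  rintro _ (rfl | rfl)
  · have := h 1 0
    rwa [pow_one, pow_zero, mul_one] at this
  · have := h 0 1
    rwa [pow_one, pow_zero, one_mul] at this

/-- A central element of the quantum torus is a polynomial in `z_1, z_2`, up to monomials with
a negative exponent. -/
theorem exists_sub_hasNeg_of_centralSupp (hq : ∀ n : ℤ, n ≠ 0 → q ^ n ≠ 1) {f : QTorus q Om}
    (hf : CentralSupp f) : ∃ u ∈ Algebra.adjoin K {z1 K (q : K), z2 K (q : K)},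
      ∀ v, coeff v (f - toTorus q u) ≠ 0 → HasNeg v := by
  have hM : ∀ v, IsCentral Om v → ∀ c : K,
      ∃ u ∈ Algebra.adjoin K {z1 K (q : K), z2 K (q : K)},
        ∀ w, coeff w (c • M q Om v - toTorus q u) ≠ 0 → HasNeg w := by
    intro v hv c
    by_cases hn : HasNeg v
    · refine ⟨0, zero_mem _, fun w hw => ?_⟩
      rw [map_zero, sub_zero, map_smul, coeff_M] at hw
      by_cases h : v = w
      · exact h ▸ hn
      · simp [h] at hw
    · have hn' : ∀ i, 0 ≤ v i := fun i => not_lt.mp fun h => hn ⟨i, h⟩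
      obtain ⟨d, hd, h⟩ := toTorus_z1_pow_mul_z2_pow (K := K) hq (v 0).toNat (v 1).toNat
      have hv' : (v 0).toNat • zExp 0 + (v 1).toNat • zExp 1 = v := by
        rw [isCentral_iff] at hv
        funext i
        have := hn' 0
        have := hn' 1
        fin_cases i <;> simp [zExp] <;> omega
      rw [hv'] at h
      refine ⟨(c * d⁻¹) • (z1 K (q : K) ^ (v 0).toNat * z2 K (q : K) ^ (v 1).toNat),
        Subalgebra.smul_mem _ (mul_mem (pow_mem (Algebra.subset_adjoin (by simp)) _)
          (pow_mem (Algebra.subset_adjoin (by simp)) _)) _, fun w hw => ?_⟩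
      rw [map_smul, h, smul_smul, mul_assoc, inv_mul_cancel₀ hd, mul_one, sub_self, map_zero] at hw
      exact absurd rfl hw
  choose! u hu huv using hM
  refine ⟨∑ v ∈ supp f, u v (coeff v f),
    sum_mem fun v hv => hu v (hf v (mem_supp.mp hv)) _, fun w hw => ?_⟩
  by_contra hn
  apply hw
  nth_rewrite 1 [eq_sum f]
  rw [map_sum, ← Finset.sum_sub_distrib, map_sum]
  refine Finset.sum_eq_zero fun v hv => ?_
  by_contra h
  exact hn (huv v (hf v (mem_supp.mp hv)) _ w h)

/-- The image of a nonzero element has a leading exponent without negative coordinates. -/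
theorem eq_zero_of_hasNeg (hq : ∀ n : ℤ, n ≠ 0 → q ^ n ≠ 1) {u : Uq K (q : K)}
    (h : ∀ v, coeff v (toTorus q u) ≠ 0 → HasNeg v) : u = 0 := by
  by_contra hu
  obtain ⟨a, ha⟩ := exists_isLead hq hu
  obtain ⟨i, hi⟩ := h _ ha.2
  exact absurd hi (by simp)

theorem center_eq_adjoin (hq : ∀ n : ℤ, n ≠ 0 → q ^ n ≠ 1) :
    Subalgebra.center K (Uq K (q : K)) = Algebra.adjoin K {z1 K (q : K), z2 K (q : K)} := by
  refine le_antisymm (fun u hu => ?_) (adjoin_le_center hq)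
  obtain ⟨w, hw, h⟩ := exists_sub_hasNeg_of_centralSupp hq (centralSupp_of_mem_center hq hu)
  rw [← map_sub] at h
  rw [sub_eq_zero.mp (eq_zero_of_hasNeg hq h)]
  exact hw

/-- The monomials in `z_1, z_2` have distinct leading exponents, so `z_1, z_2` are algebraically
independent. -/
theorem exists_mvPolynomial_equiv_center (hq : ∀ n : ℤ, n ≠ 0 → q ^ n ≠ 1) :
    ∃ φ : MvPolynomial (Fin 2) K ≃ₐ[K] Subalgebra.center K (Uq K (q : K)),
      (φ (MvPolynomial.X 0) : Uq K (q : K)) = z1 K q ∧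
      (φ (MvPolynomial.X 1) : Uq K (q : K)) = z2 K q := by
  have hc := adjoin_le_center (K := K) hq
  let Z1 : Subalgebra.center K (Uq K (q : K)) := ⟨z1 K q, hc (Algebra.subset_adjoin (by simp))⟩
  let Z2 : Subalgebra.center K (Uq K (q : K)) := ⟨z2 K q, hc (Algebra.subset_adjoin (by simp))⟩
  let φ : MvPolynomial (Fin 2) K →ₐ[K] Subalgebra.center K (Uq K (q : K)) :=
    MvPolynomial.aeval ![Z1, Z2]
  have h0 : φ (MvPolynomial.X 0) = Z1 := by simp [φ]
  have h1 : φ (MvPolynomial.X 1) = Z2 := by simp [φ]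
  have hinj : Function.Injective φ := by
    rw [injective_iff_map_eq_zero]
    intro p hp
    by_contra hp0
    have hlead : ∀ m : Fin 2 →₀ ℕ, IsLead key
        (toTorus q (z1 K (q : K) ^ m 0 * z2 K (q : K) ^ m 1)) (m 0 • zExp 0 + m 1 • zExp 1) := by
      intro m
      obtain ⟨c, hc, h⟩ := toTorus_z1_pow_mul_z2_pow (K := K) hq (m 0) (m 1)
      rw [h]
      exact (isLead_M _).smul hc
    obtain ⟨m, -, -, hm⟩ := exists_isLead_sum key_injective (s := p.support)
      (fun m => p.coeff m) (v := fun m : Fin 2 →₀ ℕ => m 0 • zExp 0 + m 1 • zExp 1) (by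
        intro m m' h
        have e0 := congrFun h 0
        have e1 := congrFun h 1
        simp [zExp] at e0 e1
        ext i
        fin_cases i
        · exact e0
        · exact e1) hlead (by
        obtain ⟨m, hm⟩ := MvPolynomial.ne_zero_iff.mp hp0
        exact ⟨m, MvPolynomial.mem_support_iff.mpr hm, hm⟩)
    have hval : ((φ p : Subalgebra.center K (Uq K (q : K))) : Uq K (q : K)) =
        ∑ m ∈ p.support, p.coeff m • (z1 K (q : K) ^ m 0 * z2 K (q : K) ^ m 1) := by
      simp only [φ, MvPolynomial.aeval_def, MvPolynomial.eval₂_eq', Fin.prod_univ_two,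
        ← Algebra.smul_def]
      simp [Z1, Z2]
    apply hm.2
    have : ∑ m ∈ p.support, p.coeff m •
        toTorus q (z1 K (q : K) ^ m 0 * z2 K (q : K) ^ m 1) = 0 := by
      simp only [← map_smul, ← map_sum]
      rw [← hval, hp]
      simp
    rw [this, map_zero]
  have hsurj : Function.Surjective φ := by
    rintro ⟨u, hu⟩
    have hu' := hu
    rw [center_eq_adjoin hq] at hu'
    have hle : Algebra.adjoin K {z1 K (q : K), z2 K (q : K)} ≤
        ((Subalgebra.center K (Uq K (q : K))).val.comp φ).range := by
      refine Algebra.adjoin_le ?_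
      rintro _ (rfl | rfl)
      · exact ⟨MvPolynomial.X 0, by
          change ((φ _ : Subalgebra.center K _) : Uq K (q : K)) = _; rw [h0]⟩
      · exact ⟨MvPolynomial.X 1, by
          change ((φ _ : Subalgebra.center K _) : Uq K (q : K)) = _; rw [h1]⟩
    obtain ⟨p, hp⟩ := hle hu'
    exact ⟨p, Subtype.ext hp⟩
  exact ⟨AlgEquiv.ofBijective φ ⟨hinj, hsurj⟩, congrArg Subtype.val h0, congrArg Subtype.val h1⟩

end Center

/-! ### Derivations of `U_q(sl_4^+)` -/

section Derivations

variable {K : Type*} [Field K] {q : Kˣ}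

/-- `D_1, D_4, D_6` as a family. -/
def Dfam (K : Type*) [Field K] (q : K) : Fin 3 → Der K (Uq K q) := ![D1 K q, D4 K q, D6 K q]

/-- The eigenvalue of `X_i` under the `j`-th member of `Dfam`. -/
def Dwt : Fin 3 → Fin 6 → ℤ :=
  ![![1, 1, 1, 0, 0, 0], ![0, 1, 1, 1, 1, 0], ![0, 0, 1, 0, 1, 1]]

theorem isDiagonalOnPBW_D1 (K : Type*) [Field K] (q : K) :
    IsDiagonalOnPBW K q (D1 K q) ![1, 1, 1, 0, 0, 0] := by
  simpa [D1] using diagDer_PBW K q ![1, 0, 0]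

theorem isDiagonalOnPBW_D4 (K : Type*) [Field K] (q : K) :
    IsDiagonalOnPBW K q (D4 K q) ![0, 1, 1, 1, 1, 0] := by
  simpa [D4] using diagDer_PBW K q ![0, 1, 0]

theorem isDiagonalOnPBW_D6 (K : Type*) [Field K] (q : K) :
    IsDiagonalOnPBW K q (D6 K q) ![0, 0, 1, 0, 1, 1] := by
  simpa [D6] using diagDer_PBW K q ![0, 0, 1]

theorem Dfam_Xs (q : K) (j : Fin 3) (i : Fin 6) :
    (Dfam K q j : Uq K q →ₗ[K] Uq K q) (Xs K q i) = (Dwt j i : K) • Xs K q i := by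
  fin_cases j
  · exact (isDiagonalOnPBW_D1 K q i).trans (by fin_cases i <;> simp [Dwt, Xs])
  · exact (isDiagonalOnPBW_D4 K q i).trans (by fin_cases i <;> simp [Dwt, Xs])
  · exact (isDiagonalOnPBW_D6 K q i).trans (by fin_cases i <;> simp [Dwt, Xs])

theorem Dfam_e (q : K) (j : Fin 3) (i : Fin 3) :
    (Dfam K q j : Uq K q →ₗ[K] Uq K q) (e K q i) = (if i = j then (1 : K) else 0) • e K q i := by
  fin_cases j
  · exact (diagDer_e K q ![1, 0, 0] i).trans (by fin_cases i <;> simp)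
  · exact (diagDer_e K q ![0, 1, 0] i).trans (by fin_cases i <;> simp)
  · exact (diagDer_e K q ![0, 0, 1] i).trans (by fin_cases i <;> simp)

/-- Under the three exchange constraints, `diag ζ` acts on `U_q(sl_4^+)` as a combination of
`D_1, D_4, D_6` with coefficients in the center of the quantum torus. -/
theorem diag_toTorus {Z : Fin 6 → QTorus q Om} (hZ : ∀ i, CentralSupp (Z i))
    (h1 : Z 1 = Z 0 + Z 3) (h2 : Z 1 + Z 4 = Z 2 + Z 3) (h3 : Z 4 = Z 3 + Z 5)
    (u : Uq K (q : K)) : diag (zetaOf Z) (toTorus q u) =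
      ∑ j, ![Z 0, Z 3, Z 5] j * toTorus q ((Dfam K q j : Uq K (q : K) →ₗ[K] Uq K q) u) := by
  have hZ' : ∀ j, CentralSupp (![Z 0, Z 3, Z 5] j) := by
    intro j
    fin_cases j
    exacts [hZ 0, hZ 3, hZ 5]
  set Y := ![Z 0, Z 3, Z 5]
  let F : Uq K (q : K) →ₗ[K] QTorus q Om := diag (zetaOf Z) ∘ₗ (toTorus q).toLinearMap -
    ∑ j, LinearMap.mulLeft K (Y j) ∘ₗ (toTorus q).toLinearMap ∘ₗ (Dfam K (q : K) j).1
  have hFapp : ∀ u, F u = diag (zetaOf Z) (toTorus q u) -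
      ∑ j, Y j * toTorus q ((Dfam K q j : Uq K (q : K) →ₗ[K] Uq K q) u) := fun u => by
    simp [F]
  refine sub_eq_zero.mp ((hFapp u).symm.trans (eq_zero_of_e (fun a b => ?_) (fun i => ?_) u))
  · have hL : ∀ j, Y j * toTorus q ((Dfam K q j : Uq K (q : K) →ₗ[K] Uq K q) (a * b)) =
        Y j * toTorus q ((Dfam K q j : Uq K (q : K) →ₗ[K] Uq K q) a) * toTorus q b +
        toTorus q a * (Y j * toTorus q ((Dfam K q j : Uq K (q : K) →ₗ[K] Uq K q) b)) := by
      intro j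
      rw [(Dfam K (q : K) j).2 a b, map_add, map_mul, map_mul, mul_add, ← mul_assoc, ← mul_assoc,
        ← mul_assoc, (hZ' j).commute (toTorus q a)]
    simp only [hFapp, hL, map_mul, diag_mul (centralSupp_zetaOf hZ), Finset.sum_add_distrib,
      Finset.sum_mul, Finset.mul_sum, sub_mul, mul_sub]
    abel
  · have h2' : Z 2 = Z 1 + Z 4 - Z 3 := by rw [h2]; abel
    rw [hFapp]
    simp only [Dfam_e, toTorus_e, map_smul, Fin.sum_univ_three]
    fin_cases i
    · simp [eT, diag_M, zetaOf_apply, Y]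
    · simp [eT, diag_M, zetaOf_apply, Y, h1, mul_add]
    · simp [eT, diag_M, zetaOf_apply, Y, h2', h1, h3, mul_add]
      rw [← sub_mul]
      convert zero_mul (M q Om ![0, -1, 1, 0, 0, 0])
      abel

/-- If a combination of an inner derivation of the quantum torus and of `D_1, D_4, D_6` with
central coefficients preserves `U_q(sl_4^+)`, while all exponents involved have a negative
coordinate, then the combination is trivial: otherwise, its values on the `X_i` have leading
exponents with a negative coordinate. -/
theorem eq_zero_of_hasNeg_of_mem_range (hq : ∀ n : ℤ, n ≠ 0 → q ^ n ≠ 1) {x : QTorus q Om}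
    (hx : ∀ v, coeff v x ≠ 0 → HasNeg v) (hxc : ∀ v, coeff v x ≠ 0 → ¬ IsCentral Om v)
    {Y : Fin 3 → QTorus q Om} (hY : ∀ j, CentralSupp (Y j))
    (hYn : ∀ j v, coeff v (Y j) ≠ 0 → HasNeg v)
    (h : ∀ u, x * toTorus q u - toTorus q u * x +
      ∑ j, Y j * toTorus q ((Dfam K q j : Uq K (q : K) →ₗ[K] Uq K q) u) ∈
        (toTorus (K := K) q).range) : x = 0 ∧ ∀ j, Y j = 0 := by
  by_contra hne
  let S : Finset (Fin 6 → ℤ) := supp x ∪ Finset.univ.biUnion fun j => supp (Y j)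
  have hS : S.Nonempty := by
    by_contra hS
    rw [Finset.not_nonempty_iff_eq_empty, Finset.union_eq_empty, Finset.eq_empty_iff_forall_notMem,
      Finset.eq_empty_iff_forall_notMem] at hS
    refine hne ⟨ext fun v => ?_, fun j => ext fun v => ?_⟩
    · have := hS.1 v
      rwa [mem_supp, not_not] at this
    · have := hS.2 v
      simp only [Finset.mem_biUnion, Finset.mem_univ, true_and, not_exists, mem_supp,
        not_not] at this
      exact this j
  obtain ⟨v, hvS, hmax⟩ := Finset.exists_max_image S key hS
  have hxle : SuppLE key x v := fun w hw =>
    hmax w (Finset.mem_union_left _ (mem_supp.mpr hw))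
  have hYle : ∀ j, SuppLE key (Y j) v := fun j w hw => hmax w (Finset.mem_union_right _
    (Finset.mem_biUnion.mpr ⟨j, Finset.mem_univ _, mem_supp.mpr hw⟩))
  have hvS' : coeff v x ≠ 0 ∨ ∃ j, coeff v (Y j) ≠ 0 := by
    rcases Finset.mem_union.mp hvS with h | h
    · exact Or.inl (mem_supp.mp h)
    · obtain ⟨j, -, hj⟩ := Finset.mem_biUnion.mp h
      exact Or.inr ⟨j, mem_supp.mp hj⟩
  have hneg : HasNeg v := by
    rcases hvS' with h | ⟨j, h⟩
    exacts [hx v h, hYn j v h]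
  -- the coefficient of the value on `X_i` at the exponent `v + e_i`
  have hcoeff : ∀ i, coeff v x * (((q ^ Om v (Pi.single i 1) : Kˣ) : K) -
      ((q ^ Om (Pi.single i 1) v : Kˣ) : K)) +
      ∑ j, coeff v (Y j) * (Dwt j i : K) * ((q ^ Om v (Pi.single i 1) : Kˣ) : K) ≠ 0 →
      ∀ k, 0 ≤ (v + Pi.single i 1 : Fin 6 → ℤ) k := by
    intro i hi
    obtain ⟨w, hw⟩ := h (Xs K (q : K) i)
    obtain ⟨hle, hc⟩ := isLead_Xs (K := K) hq i
    have hlead : IsLead key (toTorus q w) (v + Pi.single i 1) := by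
      change toTorus q w = _ at hw
      rw [hw]
      constructor
      · refine SuppLE.add ?_ (SuppLE.sum fun j _ => ?_)
        · rw [sub_eq_add_neg, ← neg_one_smul K]
          refine SuppLE.add (hxle.mul hle) (SuppLE.smul ?_ _)
          rw [add_comm]
          exact hle.mul hxle
        · rw [Dfam_Xs, map_smul, mul_smul_comm]
          exact ((hYle j).mul hle).smul _
      · have e1 := coeff_mul_top key_injective hxle hle
        have e2 := coeff_mul_top key_injective hle hxle
        rw [add_comm (Pi.single i 1) v] at e2
        simp only [Dfam_Xs, map_smul, mul_smul_comm, map_add, map_sub, map_sum, e1, e2,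
          coeff_mul_top key_injective (hYle _) hle, smul_eq_mul]
        have e3 := mul_ne_zero hc hi
        rw [mul_add, Finset.mul_sum] at e3
        convert e3 using 2
        · ring
        · exact Finset.sum_congr rfl fun j _ => by ring
    have hw0 : w ≠ 0 := fun h0 => hlead.2 (by rw [h0, map_zero, map_zero])
    obtain ⟨a, ha⟩ := exists_isLead hq hw0
    rw [hlead.unique key_injective ha]
    intro k
    simp
  obtain ⟨k, hk⟩ := hneg
  by_cases hv : IsCentral Om v
  · have hx0 : coeff v x = 0 := not_not.mp fun h => hxc v h hv
    obtain ⟨j, hj⟩ := hvS'.resolve_left (not_not.mpr hx0)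
    -- `X_1`, `X_4` and `X_6` each have nonzero weight for exactly one of the three derivations
    have := hcoeff (![0, 3, 5] j) (by
      have hu := fun i => zpow_ne_zero (Om v (Pi.single i 1)) q.ne_zero
      rw [hx0, zero_mul, zero_add, Fin.sum_univ_three]
      fin_cases j
      · simpa [Dwt] using ⟨hj, hu 0⟩
      · simpa [Dwt] using ⟨hj, hu 3⟩
      · simpa [Dwt] using ⟨hj, hu 5⟩)
    have f0 := this 0
    have f1 := this 1
    have f2 := this 2
    have f3 := this 3
    have f4 := this 4
    have f5 := this 5
    rw [isCentral_iff] at hv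
    fin_cases j <;> simp at f0 f1 f2 f3 f4 f5 <;> fin_cases k <;>
      simp at hk <;> omega
  · have hY0 : ∀ j, coeff v (Y j) = 0 := fun j => not_not.mp fun h => hv (hY j v h)
    have hx0 : coeff v x ≠ 0 := hvS'.resolve_right (by simp [hY0])
    have hβ : ∀ i, i ≠ k → β Om v (Pi.single i 1) = 0 := by
      intro i hik
      by_contra hβ
      have := hcoeff i (by
        simp only [hY0, zero_mul, Finset.sum_const_zero, add_zero]
        refine mul_ne_zero hx0 fun h0 => hq _ hβ ?_
        rw [β, zpow_sub, mul_inv_eq_one]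
        exact Units.ext (sub_eq_zero.mp h0)) k
      rw [Pi.add_apply, Pi.single_eq_of_ne hik.symm] at this
      omega
    have g0 := hβ 0
    have g1 := hβ 1
    have g2 := hβ 2
    have g3 := hβ 3
    have g4 := hβ 4
    have g5 := hβ 5
    rw [isCentral_iff] at hv
    fin_cases k <;> simp [β_Om] at g0 g1 g2 g3 g4 g5 hk <;> omega

/-- Modulo elements of `U_q(sl_4^+)` and its center, the data `x` and `Y_j` of a derivation on the
quantum torus are supported on exponents with a negative coordinate, where they have to vanish by
`eq_zero_of_hasNeg_of_mem_range`. -/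
theorem exists_decomposition (hq : ∀ n : ℤ, n ≠ 0 → q ^ n ≠ 1) (D : Der K (Uq K (q : K))) :
    ∃ (x : Uq K (q : K)) (ν : Fin 3 → Subalgebra.center K (Uq K (q : K))),
      D = ad K _ x + ∑ j, ν j • Dfam K q j := by
  classical
  obtain ⟨x, Z, hZ, hD⟩ := exists_eq_torusDer hq (D := (toTorus q).toLinearMap ∘ₗ D.1)
    (fun a b => by
      change toTorus q ((D : Uq K (q : K) →ₗ[K] Uq K q) (a * b)) = _
      rw [D.2 a b, map_add, map_mul, map_mul]
      rfl)
  have hrange : ∀ u, torusDer x (zetaOf Z) (toTorus q u) ∈ (toTorus (K := K) q).range :=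
    fun u => ⟨_, hD u⟩
  have hdiag := diag_toTorus hZ (exchange_X1 hZ hrange) (exchange_X2 hq hZ hrange)
    (exchange_X2op hq hZ hrange)
  have hZ' : ∀ j, CentralSupp (![Z 0, Z 3, Z 5] j) := by
    intro j
    fin_cases j
    exacts [hZ 0, hZ 3, hZ 5]
  set Y := ![Z 0, Z 3, Z 5]
  obtain ⟨x₀, hx₀⟩ := exists_sub_hasNeg hq x
  choose ν hν hνn using fun j => exists_sub_hasNeg_of_centralSupp hq (hZ' j)
  have hνc := fun j => adjoin_le_center hq (hν j)
  -- the central and the noncentral part of `x - x₀`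
  let x₁ := x - toTorus q x₀
  let xc : QTorus q Om := Finsupp.filter (IsCentral Om) x₁
  have hxc : ∀ v, coeff v xc = if IsCentral Om v then coeff v x₁ else 0 := fun v => rfl
  have hxcent : CentralSupp xc := fun v hv => by
    by_contra h
    rw [hxc, if_neg h] at hv
    exact hv rfl
  have hval : ∀ u, toTorus q ((D : Uq K (q : K) →ₗ[K] Uq K q) u - (x₀ * u - u * x₀ +
      ∑ j, ν j * (Dfam K q j : Uq K (q : K) →ₗ[K] Uq K q) u)) =
      (x₁ - xc) * toTorus q u - toTorus q u * (x₁ - xc) +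
      ∑ j, (Y j - toTorus q (ν j)) * toTorus q ((Dfam K q j : Uq K (q : K) →ₗ[K] Uq K q) u) := by
    intro u
    have hDu : toTorus q ((D : Uq K (q : K) →ₗ[K] Uq K q) u) =
      torusDer x (zetaOf Z) (toTorus q u) := hD u
    have hcomm := hxcent.commute (toTorus q u)
    rw [map_sub, hDu, torusDer_apply, hdiag]
    simp only [map_add, map_sub, map_mul, map_sum, sub_mul, mul_sub, Finset.sum_sub_distrib,
      hcomm, x₁]
    abel
  obtain ⟨hx0, hY0⟩ := eq_zero_of_hasNeg_of_mem_range hq (x := x₁ - xc)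
    (Y := fun j => Y j - toTorus q (ν j))
    (fun v hv => hx₀ v fun h => hv (by
      rw [map_sub, hxc, show coeff v x₁ = 0 from h, ite_self, sub_zero]))
    (fun v hv hc => hv (by rw [map_sub, hxc, if_pos hc, sub_self]))
    (fun j => (hZ' j).sub (centralSupp_of_mem_center hq (hνc j)))
    (fun j => hνn j) (fun u => ⟨_, hval u⟩)
  refine ⟨x₀, fun j => ⟨ν j, hνc j⟩, Subtype.ext (LinearMap.ext fun u => ?_)⟩
  have h0 := hval u
  simp only [hx0, hY0, zero_mul, mul_zero, sub_zero, Finset.sum_const_zero, add_zero] at h0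
  rw [map_eq_zero_iff _ (toTorus_injective hq), sub_eq_zero] at h0
  rw [h0]
  simp [ad_apply, Subalgebra.smul_def]

theorem eq_zero_of_ad_add (hq : ∀ n : ℤ, n ≠ 0 → q ^ n ≠ 1) {x : Uq K (q : K)}
    {ν : Fin 3 → Subalgebra.center K (Uq K (q : K))}
    (h : ad K _ x + ∑ j, ν j • Dfam K q j = 0) : ν = 0 := by
  have happ : ∀ u, x * u - u * x +
      ∑ j, (ν j : Uq K (q : K)) * (Dfam K q j : Uq K (q : K) →ₗ[K] Uq K q) u = 0 := by
    intro u
    have := congrArg (fun D : Der K (Uq K (q : K)) => (D : Uq K (q : K) →ₗ[K] Uq K q) u) h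
    simpa [ad_apply, Subalgebra.smul_def] using this
  -- an inner derivation of the torus cannot rescale a monomial by a nonzero central element
  have key : ∀ (X f : QTorus q Om) (w : Fin 6 → ℤ) (c : K), c ≠ 0 → CentralSupp f →
      X * (c • M q Om w) - (c • M q Om w) * X + f * (c • M q Om w) = 0 → f = 0 := by
    intro X f w c hc hf h
    have h1 : c • ((X - conj q Om w X + f) * M q Om w) = 0 := by
      rw [← h, add_mul, sub_mul, ← M_mul_eq_conj_mul]
      simp only [mul_smul_comm, smul_mul_assoc, smul_add, smul_sub]
    have h2 := (isUnit_M w).mul_left_eq_zero.mp ((smul_eq_zero.mp h1).resolve_left hc)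
    refine ext fun v => ?_
    rw [map_zero]
    by_contra hv
    have h3 := congrArg (coeff v) h2
    rw [map_add, map_sub, coeff_conj, β_swap, hf v hv] at h3
    simp at h3
    exact hv h3
  have hsum : ∀ i, x * Xs K (q : K) i - Xs K (q : K) i * x +
      (∑ j, (Dwt j i : K) • (ν j : Uq K (q : K))) * Xs K (q : K) i = 0 := by
    intro i
    rw [← happ (Xs K (q : K) i), Finset.sum_mul]
    simp only [Dfam_Xs, mul_smul_comm, smul_mul_assoc]
  have hmono : ∀ i w (c : K), c ≠ 0 → toTorus q (Xs K (q : K) i) = c • M q Om w →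
      ∑ j, (Dwt j i : K) • (ν j : Uq K (q : K)) = 0 := by
    intro i w c hc0 hw
    have h1 := congrArg (toTorus q) (hsum i)
    rw [map_add, map_sub, map_mul, map_mul, map_mul, hw, map_zero] at h1
    have hmem : ∑ j, (Dwt j i : K) • (ν j : Uq K (q : K)) ∈ Subalgebra.center K (Uq K (q : K)) :=
      Subalgebra.sum_mem _ fun j _ => Subalgebra.smul_mem _ (ν j).2 _
    have h2 := key _ _ _ _ hc0 (centralSupp_of_mem_center hq hmem) h1
    exact (map_eq_zero_iff _ (toTorus_injective hq)).mp h2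
  have hc := one_sub_ne_zero (K := K) hq
  have h1 := hmono 0 _ 1 one_ne_zero ((toTorus_X1 q).trans (one_smul K _).symm)
  have h2 := hmono 1 _ _ hc (toTorus_X2 q)
  have h3 := hmono 2 _ _ (pow_ne_zero 2 hc) (toTorus_X3 q)
  simp only [Dwt, Fin.sum_univ_three, Matrix.cons_val, Int.cast_one, Int.cast_zero, one_smul,
    zero_smul, add_zero, Fin.isValue] at h1 h2 h3
  rw [h1, zero_add] at h2 h3
  rw [h2, zero_add] at h3
  funext j
  fin_cases j
  exacts [Subtype.ext h1, Subtype.ext h2, Subtype.ext h3]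

end Derivations

/-! ### The first Hochschild cohomology -/

section Cohomology

variable {K : Type*} [Field K]

theorem nontrivial_Uq (q : Kˣ) : Nontrivial (Uq K (q : K)) := by
  refine ⟨0, 1, fun h => ?_⟩
  have h1 := congrArg (fun u => coeff 0 (toTorus q u)) h
  simp [one_def, coeff_M] at h1

theorem zpow_units_ne_one {q : K} (hq0 : q ≠ 0) (hq : ∀ n : ℕ, 0 < n → q ^ n ≠ 1) (n : ℤ)
    (hn : n ≠ 0) : (Units.mk0 q hq0) ^ n ≠ 1 := by
  have hnat : ∀ m : ℕ, 0 < m → (Units.mk0 q hq0) ^ m ≠ 1 := fun m hm h =>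
    hq m hm (by simpa using congrArg Units.val h)
  rcases Int.eq_nat_or_neg n with ⟨m, rfl | rfl⟩
  · rw [zpow_natCast]
    exact hnat m (by omega)
  · rw [zpow_neg, zpow_natCast, inv_ne_one]
    exact hnat m (by omega)

theorem existsUnique_decomposition {q : Kˣ} (hq : ∀ n : ℤ, n ≠ 0 → q ^ n ≠ 1)
    (D : Der K (Uq K (q : K))) :
    ∃! p : InnDer K (Uq K (q : K)) × (Fin 3 → Subalgebra.center K (Uq K (q : K))),
      D = p.1 + p.2 0 • D1 K (q : K) + p.2 1 • D4 K (q : K) + p.2 2 • D6 K (q : K) := by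
  have hsum : ∀ (d : Der K (Uq K (q : K))) (ν : Fin 3 → Subalgebra.center K (Uq K (q : K))),
      d + ν 0 • D1 K (q : K) + ν 1 • D4 K (q : K) + ν 2 • D6 K (q : K) =
        d + ∑ j, ν j • Dfam K (q : K) j := by
    intro d ν
    rw [Fin.sum_univ_three, ← add_assoc, ← add_assoc]
    rfl
  obtain ⟨x, ν, hx⟩ := exists_decomposition hq D
  refine ⟨(⟨ad K _ x, x, rfl⟩, ν), ?_, ?_⟩
  · beta_reduce
    rw [hsum]
    exact hx
  · rintro ⟨⟨_, y, rfl⟩, μ⟩ hy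
    rw [hsum] at hy
    have hadd : ad K (Uq K (q : K)) (y - x) = ad K _ y - ad K _ x := by
      refine Subtype.ext (LinearMap.ext fun a => ?_)
      rw [ad_apply, AddSubgroupClass.coe_sub, LinearMap.sub_apply, ad_apply, ad_apply]
      noncomm_ring
    have h0 : μ - ν = 0 := eq_zero_of_ad_add hq (x := y - x) (by
      simp only [Pi.sub_apply, sub_smul, Finset.sum_sub_distrib, hadd]
      have hxy := hx.symm.trans hy
      rw [sub_add_sub_comm, sub_eq_zero]
      exact hxy.symm)
    have h1 : μ = ν := sub_eq_zero.mp h0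
    subst h1
    have h2 : ad K (Uq K (q : K)) y = ad K _ x := add_right_cancel (hy.symm.trans hx)
    exact Prod.ext (Subtype.ext h2) rfl

theorem exists_basis_HH1 {q : Kˣ} (hq : ∀ n : ℤ, n ≠ 0 → q ^ n ≠ 1) :
    ∃ b : Module.Basis (Fin 3) (Subalgebra.center K (Uq K (q : K))) (HH1 K (Uq K (q : K))),
      b 0 = Submodule.Quotient.mk (D1 K (q : K)) ∧
      b 1 = Submodule.Quotient.mk (D4 K (q : K)) ∧
      b 2 = Submodule.Quotient.mk (D6 K (q : K)) := by
  let π := (InnDer K (Uq K (q : K))).mkQ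
  have hli : LinearIndependent (Subalgebra.center K (Uq K (q : K)))
      (fun j => π (Dfam K (q : K) j)) := by
    rw [Fintype.linearIndependent_iff]
    intro g hg
    have h0 : π (∑ j, g j • Dfam K (q : K) j) = 0 := by
      rw [map_sum, ← hg]
      exact Finset.sum_congr rfl fun j _ => map_smul π _ _
    obtain ⟨x, hx⟩ : ∑ j, g j • Dfam K (q : K) j ∈ InnDer K (Uq K (q : K)) :=
      (Submodule.Quotient.mk_eq_zero _).mp h0
    have hneg : ad K (Uq K (q : K)) (-x) = -ad K _ x := by
      refine Subtype.ext (LinearMap.ext fun a => ?_)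
      rw [ad_apply, NegMemClass.coe_neg, LinearMap.neg_apply, ad_apply]
      noncomm_ring
    have hg0 : g = 0 := eq_zero_of_ad_add hq (x := -x) (by rw [hneg, hx, neg_add_cancel])
    exact fun j => congrFun hg0 j
  have hsp : ⊤ ≤ Submodule.span (Subalgebra.center K (Uq K (q : K)))
      (Set.range fun j => π (Dfam K (q : K) j)) := by
    intro y _
    obtain ⟨D, rfl⟩ := Submodule.mkQ_surjective _ y
    obtain ⟨x, ν, hx⟩ := exists_decomposition hq D
    have h0 : π (ad K _ x) = 0 :=
      (Submodule.Quotient.mk_eq_zero _).mpr (show ad K _ x ∈ InnDer K _ from ⟨x, rfl⟩)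
    have h1 : π D = π (ad K _ x) + ∑ j, π (ν j • Dfam K (q : K) j) := by
      rw [hx, map_add, map_sum]
    rw [h0, zero_add] at h1
    refine h1 ▸ sum_mem fun j _ => ?_
    rw [map_smul]
    exact Submodule.smul_mem _ _ (Submodule.subset_span ⟨j, rfl⟩)
  refine ⟨Module.Basis.mk hli hsp, ?_, ?_, ?_⟩
  · rw [Module.Basis.mk_apply]; rfl
  · rw [Module.Basis.mk_apply]; rfl
  · rw [Module.Basis.mk_apply]; rfl

end Cohomology

end UqSl4

open UqSl4 in
theorem mainTheorem2 (K : Type*) [Field K] [CharZero K] (q : K) (hq0 : q ≠ 0)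
    (hq : ∀ n : ℕ, 0 < n → q ^ n ≠ 1) :
    -- the derivations `D_1, D_4, D_6` on the PBW generators
    (IsDiagonalOnPBW K q (D1 K q) ![1, 1, 1, 0, 0, 0] ∧
      IsDiagonalOnPBW K q (D4 K q) ![0, 1, 1, 1, 1, 0] ∧
      IsDiagonalOnPBW K q (D6 K q) ![0, 0, 1, 0, 1, 1]) ∧
    -- the center is the polynomial algebra `K[z_1, z_2]`
    (∃ φ : MvPolynomial (Fin 2) K ≃ₐ[K] Subalgebra.center K (Uq K q),
      (φ (MvPolynomial.X 0) : Uq K q) = z1 K q ∧ (φ (MvPolynomial.X 1) : Uq K q) = z2 K q) ∧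
    -- existence and uniqueness of the decomposition
    (∀ D : Der K (Uq K q),
      ∃! p : InnDer K (Uq K q) × (Fin 3 → Subalgebra.center K (Uq K q)),
        D = p.1 + p.2 0 • D1 K q + p.2 1 • D4 K q + p.2 2 • D6 K q) ∧
    -- the first Hochschild cohomology is free of rank 3 on the classes of `D_1, D_4, D_6`
    (∃ b : Module.Basis (Fin 3) (Subalgebra.center K (Uq K q)) (HH1 K (Uq K q)),
      b 0 = Submodule.Quotient.mk (D1 K q) ∧
      b 1 = Submodule.Quotient.mk (D4 K q) ∧
      b 2 = Submodule.Quotient.mk (D6 K q)) ∧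
    Module.rank (Subalgebra.center K (Uq K q)) (HH1 K (Uq K q)) = 3 := by
  have hq' : ∀ n : ℤ, n ≠ 0 → (Units.mk0 q hq0) ^ n ≠ 1 := zpow_units_ne_one hq0 hq
  have hb := exists_basis_HH1 hq'
  refine ⟨⟨isDiagonalOnPBW_D1 K q, isDiagonalOnPBW_D4 K q, isDiagonalOnPBW_D6 K q⟩,
    exists_mvPolynomial_equiv_center hq', existsUnique_decomposition hq', hb, ?_⟩
  obtain ⟨b, -⟩ := hb
  have := nontrivial_Uq (Units.mk0 q hq0)
  have h := rank_eq_card_basis b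
  rw [Fintype.card_fin] at h
  exact_mod_cast h
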